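/- **Setting.** Let $\mathsf X$ be a measurable space whose diagonal is measurable, with a $\sigma$-finite measure $\mathrm dx$. Let $M_1$ be a probability density on $\mathsf X$, $M_t(x,y)$ ($t\ge 2$) Markov transition densities, and $G_1:\mathsf X\to[0,\infty)$, $G_t:\mathsf X^2\to[0,\infty)$ ($t\ge2$) measurable potentials. Write $G_*(t),G^*(t)$ and $M_*(t),M^*(t)$ for the infimum and supremum of $G_t$ and $M_t$ over their arguments. *Strong mixing (horizon $T$):* $0<G_*(t)\le G^*(t)<\infty$ for $1\le t\le T$ and $0<M_*(t)\le M^*(t)<\infty$ for $2\le t\le T$. Put $$\boldsymbol\epsilon=\min_{1\le t\le T-1}\frac{G_*(t)\,M_*(t+1)\,G_*(t+1)}{G^*(t)\,M^*(t+1)\,G^*(t+1)}\quad(T\ge2),\qquad \boldsymbol\epsilon=\frac{G_*(1)}{G^*(1)}\quad(T=1).$$ *Index coupled resampling.* For positive weight vectors $\omega,\tilde\omega\in(0,\infty)^N$ with normalisations $w,\tilde w$, let $p_c=\sum_j w^{(j)}\wedge\tilde w^{(j)}$. A draw from $\mathrm{CRes}(\omega,\tilde\omega)$ is a pair $(I,\tilde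 I)$ of indices: with probability $p_c$, $I=\tilde I$ is drawn with probabilities $(w^{(i)}\wedge\tilde w^{(i)})/p_c$; otherwise $I$ and $\tilde I$ are drawn independently with probabilities $(w^{(i)}-w^{(i)}\wedge\tilde w^{(i)})/(1-p_c)$ and $(\tilde w^{(i)}-w^{(i)}\wedge\tilde w^{(i)})/(1-p_c)$ respectively. *CCBPF with $N$ particles* maps two trajectories $x^*_{1:T},\tilde x^*_{1:T}$ to two random trajectories as follows. Set $X_t^{(1)}=x_t^*$, $\tilde X_t^{(1)}=\tilde x_t^*$ for all $t$. Draw $X_1^{(i)}=\tilde X_1^{(i)}\sim M_1$ independently for $2\le i\le N$; set $\omega_1^{(i)}=G_1(X_1^{(i)})$, $\tilde\omega_1^{(i)}=G_1(\tilde X_1^{(i)})$. For $t=2,\dots,T$: draw independent pairs $(I_t^{(i)},\tilde I_t^{(i)})\sim\mathrm{CRes}(\omega_{t-1},\tilde\omega_{t-1})$ for $2\le i\le N$, and put $I_t^{(1)}=\tilde I_t^{(1)}=1$; draw $(X_t^{(i)},\tilde X_t^{(i)})_{2\le i\le N}$ given the parents, by any strategy under which the $X_t^{(i)}$ are independent with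 $X_t^{(i)}\sim M_t(X_{t-1}^{(I_t^{(i)})},\cdot)$, the $\tilde X_t^{(i)}$ are independent with $\tilde X_t^{(i)}\sim M_t(\tilde X_{t-1}^{(\tilde I_t^{(i)})},\cdot)$, and $X_t^{(i)}=\tilde X_t^{(i)}$ almost surely whenever $X_{t-1}^{(I_t^{(i)})}=\tilde X_{t-1}^{(\tilde I_t^{(i)})}$; set $\omega_t^{(i)}=G_t(X_{t-1}^{(I_t^{(i)})},X_t^{(i)})$, $\tilde\omega_t^{(i)}=G_t(\tilde X_{t-1}^{(\tilde I_t^{(i)})},\tilde X_t^{(i)})$ for $1\le i\le N$. Then draw $(J_T,\tilde J_T)\sim\mathrm{CRes}(\omega_T,\tilde\omega_T)$ and, for $t=T-1,\dots,1$, $(J_t,\tilde J_t)\sim\mathrm{CRes}(b_t,\tilde b_t)$ with $b_t^{(i)}=\omega_t^{(i)}M_{t+1}(X_t^{(i)},X_{t+1}^{(J_{t+1})})G_{t+1}(X_t^{(i)},X_{t+1}^{(J_{t+1})})$ and $\tilde b_t$ defined in the same way from the second system. The output is $(X_{1:T}^{(J_{1:T})},\tilde X_{1:T}^{(\tilde J_{1:T})})$.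 **Theorem.** Let $(S_0,\tilde S_0)=(s_{\mathrm{ref}},\tilde s_{\mathrm{ref}})\in\mathsf X^T\times\mathsf X^T$, let $(S_k,\tilde S_k)$, $k\ge1$, be the Markov chain obtained by iterating CCBPF with $N$ particles, and let $\tau=\inf\{k\ge1: S_k=\tilde S_k\}$. Let $\epsilon>0$. 1. For every $\rho>0$ there is $N_0=N_0(\epsilon,\rho)$ such that, for all $N\ge N_0$, $\lim_{T\to\infty}\mathbb P(\tau\ge\lceil\rho T\rceil)=0$, whenever strong mixing holds for all horizons $T>1$ with $\boldsymbol\epsilon\ge\epsilon$ (the model, the sampling strategy and the reference trajectories may vary with $T$). 2. For all $\alpha,\beta\in(1,\infty)$ there is $N_0=N_0(\epsilon,\alpha,\beta)\in\mathbb N$ such that, for all $N\ge N_0$, all $T\ge1$, every model satisfying strong mixing with $\boldsymbol\epsilon\ge\epsilon$, every sampling strategy and all reference trajectories, $$\mathbb P(\tau\ge n)\le\alpha^T\beta^{-n}\qquad\text{for all integers } n\ge0,\ n\ne1 .$$ Moreover, for all $N\ge N_0$ with this same $N_0$ and every $\rho>\log\alpha/\log\beta$, the limit in 1. holds. -/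

import Mathlib

open MeasureTheory ProbabilityTheory Filter Topology
open scoped NNReal ENNReal

universe u

noncomputable section

namespace CCBPF

/-! ### Feynman–Kac models and the strong mixing condition

Times `1, 2, 3, …` are stored at the indices `0, 1, 2, …`. The model with horizon `T` only
uses the first `T` times; the remaining terms of the sequences play no role. -/

/-- A Feynman–Kac model on `X` with dominating measure `μ`: an initial density `M₁`, Markov
transition densities and nonnegative potentials. `M t` and `G t` belong to the
move from index `t` to index `t + 1`. -/
structure Model (X : Type u) [MeasurableSpace X] (μ : Measure X) where
  M₁ : X → ℝ≥0
  G₁ : X → ℝ≥0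
  M : ℕ → X → X → ℝ≥0
  G : ℕ → X → X → ℝ≥0
  measurable_M₁ : Measurable M₁
  measurable_G₁ : Measurable G₁
  measurable_M : ∀ t, Measurable (Function.uncurry (M t))
  measurable_G : ∀ t, Measurable (Function.uncurry (G t))
  lintegral_M₁ : ∫⁻ x, (M₁ x : ℝ≥0∞) ∂μ = 1
  lintegral_M : ∀ t x, ∫⁻ y, (M t x y : ℝ≥0∞) ∂μ = 1

namespace Model

variable {X : Type u} [MeasurableSpace X] {μ : Measure X} (m : Model X μ)

/-- The initial distribution `M₁(x) dx`. -/
def init : Measure X := μ.withDensity (fun x => (m.M₁ x : ℝ≥0∞))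

/-- The transition distribution `M_t(x, y) dy` from index `t` to index `t + 1`. -/
def trans (t : ℕ) (x : X) : Measure X := μ.withDensity (fun y => (m.M t x y : ℝ≥0∞))

instance : IsProbabilityMeasure m.init :=
  ⟨by rw [init, withDensity_apply _ MeasurableSet.univ, Measure.restrict_univ, m.lintegral_M₁]⟩

/-- `G_*` at index `t`. -/
def Ginf : ℕ → ℝ≥0∞
  | 0 => ⨅ x, (m.G₁ x : ℝ≥0∞)
  | t + 1 => ⨅ (x) (y), (m.G t x y : ℝ≥0∞)

/-- `G^*` at index `t`. -/
def Gsup : ℕ → ℝ≥0∞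
  | 0 => ⨆ x, (m.G₁ x : ℝ≥0∞)
  | t + 1 => ⨆ (x) (y), (m.G t x y : ℝ≥0∞)

/-- `M_*` for the move from index `t` to index `t + 1`. -/
def Minf (t : ℕ) : ℝ≥0∞ := ⨅ (x) (y), (m.M t x y : ℝ≥0∞)

/-- `M^*` for the move from index `t` to index `t + 1`. -/
def Msup (t : ℕ) : ℝ≥0∞ := ⨆ (x) (y), (m.M t x y : ℝ≥0∞)

/-- Strong mixing up to the horizon `T`. -/
def StrongMixing (T : ℕ) : Prop :=
  (∀ t < T, 0 < m.Ginf t ∧ m.Gsup t < ∞) ∧ (∀ t, t + 1 < T → 0 < m.Minf t ∧ m.Msup t < ∞)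

/-- The constant `δ = min_t G_*(t) / G^*(t)`. -/
def deltaConst (T : ℕ) : ℝ≥0∞ := ⨅ (t) (_ : t < T), m.Ginf t / m.Gsup t

/-- The constant `ε`: the minimum of
`G_*(t) M_*(t → t+1) G_*(t+1) / (G^*(t) M^*(t → t+1) G^*(t+1))` over the moves up to the
horizon `T`. The minimum with `δ` changes nothing for `T ≥ 2`; for `T = 1` there is no move
and the constant is `δ`. -/
def epsConst (T : ℕ) : ℝ≥0∞ :=
  min (m.deltaConst T)
    (⨅ (t) (_ : t + 1 < T), (m.Ginf t * m.Minf t * m.Ginf (t + 1)) /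
      (m.Gsup t * m.Msup t * m.Gsup (t + 1)))

end Model

/-! ### Index coupled resampling -/

section Resampling

variable {N : ℕ}

/-- Normalised weights. All-zero weights, for which the categorical distribution is undefined,
are replaced by equal ones; this never happens under strong mixing. -/
def nweight (ω : Fin N → ℝ≥0) (i : Fin N) : ℝ≥0 :=
  if ∑ j, ω j = 0 then (N : ℝ≥0)⁻¹ else ω i / ∑ j, ω j

/-- The coupling probability `p_c`. -/
def pc (ω ω' : Fin N → ℝ≥0) : ℝ≥0 := ∑ j, min (nweight ω j) (nweight ω' j)

/-- The coupled weights `w_c`. -/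
def wc (ω ω' : Fin N → ℝ≥0) (i : Fin N) : ℝ≥0 :=
  min (nweight ω i) (nweight ω' i) / pc ω ω'

/-- The residual weights `w_r` of the first argument, when coupled with the second. -/
def wr (ω ω' : Fin N → ℝ≥0) (i : Fin N) : ℝ≥0 :=
  (nweight ω i - pc ω ω' * wc ω ω' i) / (1 - pc ω ω')

/-- The probability that one draw of `CRes(ω, ω')` yields the pair of indices `a`: with
probability `p_c` both indices equal a common draw from `w_c`; otherwise they are drawn
independently from the residual weights. -/
def cresMass (ω ω' : Fin N → ℝ≥0) (a : Fin N × Fin N) : ℝ≥0 :=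
  pc ω ω' * (if a.1 = a.2 then wc ω ω' a.1 else 0) +
    (1 - pc ω ω') * (wr ω ω' a.1 * wr ω' ω a.2)

theorem sum_nweight [NeZero N] (ω : Fin N → ℝ≥0) : ∑ i, nweight ω i = 1 := by
  have hN : (N : ℝ≥0) ≠ 0 := by exact_mod_cast NeZero.ne N
  unfold nweight
  split_ifs with h
  · simp [hN]
  · rw [← Finset.sum_div, div_self h]

theorem pc_comm (ω ω' : Fin N → ℝ≥0) : pc ω ω' = pc ω' ω := by
  simp [pc, min_comm]

theorem pc_le_one [NeZero N] (ω ω' : Fin N → ℝ≥0) : pc ω ω' ≤ 1 := by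
  rw [← sum_nweight ω]
  exact Finset.sum_le_sum fun i _ => min_le_left _ _

theorem pc_mul_wc (ω ω' : Fin N → ℝ≥0) (i : Fin N) :
    pc ω ω' * wc ω ω' i = min (nweight ω i) (nweight ω' i) := by
  unfold wc
  by_cases h : pc ω ω' = 0
  · have h0 : min (nweight ω i) (nweight ω' i) = 0 := by
      unfold pc at h
      exact (Finset.sum_eq_zero_iff.mp h) i (Finset.mem_univ i)
    rw [h0, h]
    simp
  · rw [mul_div_cancel₀ _ h]

theorem sum_wr [NeZero N] (ω ω' : Fin N → ℝ≥0) (h : pc ω ω' ≠ 1) : ∑ i, wr ω ω' i = 1 := by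
  have h1 : (1 : ℝ≥0) - pc ω ω' ≠ 0 := by
    rw [Ne, tsub_eq_zero_iff_le, not_le]
    exact lt_of_le_of_ne (pc_le_one ω ω') h
  have h2 : ∑ i, (nweight ω i - min (nweight ω i) (nweight ω' i)) + pc ω ω' = 1 := by
    rw [pc, ← Finset.sum_add_distrib, ← sum_nweight ω]
    exact Finset.sum_congr rfl fun i _ => tsub_add_cancel_of_le (min_le_left _ _)
  unfold wr
  simp only [pc_mul_wc]
  rw [← Finset.sum_div, eq_tsub_of_add_eq h2, div_self h1]

theorem sum_cresMass [NeZero N] (ω ω' : Fin N → ℝ≥0) : ∑ a, cresMass ω ω' a = 1 := by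
  have h1 : ∑ a : Fin N × Fin N, pc ω ω' * (if a.1 = a.2 then wc ω ω' a.1 else 0)
      = pc ω ω' := by
    rw [Fintype.sum_prod_type]
    simp only [mul_ite, mul_zero, Finset.sum_ite_eq, Finset.mem_univ, if_true, pc_mul_wc]
    rfl
  have h2 : ∑ a : Fin N × Fin N, (1 - pc ω ω') * (wr ω ω' a.1 * wr ω' ω a.2)
      = 1 - pc ω ω' := by
    rw [← Finset.mul_sum, Fintype.sum_prod_type]
    simp only [← Finset.mul_sum]
    rw [← Finset.sum_mul]
    by_cases h : pc ω ω' = 1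
    · simp [h]
    · rw [sum_wr ω ω' h, sum_wr ω' ω (by rwa [pc_comm]), mul_one, mul_one]
  unfold cresMass
  rw [Finset.sum_add_distrib, h1, h2, add_tsub_cancel_of_le (pc_le_one ω ω')]

theorem measurable_nweight (i : Fin N) : Measurable fun ω : Fin N → ℝ≥0 => nweight ω i := by
  unfold nweight
  refine Measurable.ite (measurableSet_eq_fun (by fun_prop) (by fun_prop)) (by fun_prop)
    (by fun_prop)

theorem measurable_cresMass (a : Fin N × Fin N) :
    Measurable fun p : (Fin N → ℝ≥0) × (Fin N → ℝ≥0) => cresMass p.1 p.2 a := by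
  have h1 (i : Fin N) : Measurable fun p : (Fin N → ℝ≥0) × (Fin N → ℝ≥0) => nweight p.1 i :=
    (measurable_nweight i).comp measurable_fst
  have h2 (i : Fin N) : Measurable fun p : (Fin N → ℝ≥0) × (Fin N → ℝ≥0) => nweight p.2 i :=
    (measurable_nweight i).comp measurable_snd
  unfold cresMass wr wc pc
  split_ifs <;> fun_prop

/-- The kernel to a finite type with given probability masses. -/
def finKernel {A B : Type*} [MeasurableSpace A] [MeasurableSpace B] [Fintype B]
    (p : A → B → ℝ≥0) (hp : ∀ b, Measurable fun a => p a b) : Kernel A B where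
  toFun a := ∑ b, (p a b : ℝ≥0∞) • Measure.dirac b
  measurable' := by
    refine Measure.measurable_of_measurable_coe _ fun s _ => ?_
    simp only [Measure.coe_finsetSum, Finset.sum_apply, Measure.smul_apply, smul_eq_mul]
    have := hp
    fun_prop

theorem isMarkovKernel_finKernel {A B : Type*} [MeasurableSpace A] [MeasurableSpace B]
    [Fintype B] (p : A → B → ℝ≥0) (hp : ∀ b, Measurable fun a => p a b)
    (h1 : ∀ a, ∑ b, p a b = 1) : IsMarkovKernel (finKernel p hp) := by
  refine ⟨fun a => ⟨?_⟩⟩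
  change (∑ b, (p a b : ℝ≥0∞) • Measure.dirac b : Measure B) Set.univ = 1
  simp only [Measure.coe_finsetSum, Finset.sum_apply, Measure.smul_apply, smul_eq_mul,
    measure_univ, mul_one]
  exact_mod_cast h1 a

variable (N) in
/-- The indices of the particles other than the reference particle, which has index `0`. -/
abbrev Free [NeZero N] : Type := {i : Fin N // i ≠ 0}

variable (N) in
/-- The two weight vectors `(ω, ω')`. -/
abbrev Weights : Type := (Fin N → ℝ≥0) × (Fin N → ℝ≥0)

variable (N) in
/-- `CRes(ω, ω', 1)`. -/
def cres : Kernel (Weights N) (Fin N × Fin N) :=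
  finKernel (fun p a => cresMass p.1 p.2 a) measurable_cresMass

variable (N) in
/-- `CRes(ω, ω', N - 1)`: independent draws, one for each free particle. -/
def cresFree [NeZero N] : Kernel (Weights N) (Free N → Fin N × Fin N) :=
  finKernel (fun p a => ∏ i, cresMass p.1 p.2 (a i)) fun a =>
    Finset.measurable_prod _ fun i _ => measurable_cresMass (a i)

instance [NeZero N] : IsMarkovKernel (cres N) :=
  isMarkovKernel_finKernel _ _ fun p => sum_cresMass p.1 p.2

instance [NeZero N] : IsMarkovKernel (cresFree N) :=
  isMarkovKernel_finKernel _ _ fun p => by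
    have h := Finset.prod_univ_sum (fun _ : Free N => (Finset.univ : Finset (Fin N × Fin N)))
      (fun _ a => cresMass p.1 p.2 a)
    simp only [sum_cresMass, Finset.prod_const_one, Fintype.piFinset_univ] at h
    exact h.symm

end Resampling

/-! ### The coupled conditional backward sampling particle filter -/

section Algorithm

variable {X : Type u} [MeasurableSpace X] {μ : Measure X}

/-- A sampling strategy for the coupled mutation of the free particles at every time step. Given
the pairs of parents, it draws the pairs of new particles so that, marginally, the first
components are independent draws from the transition distributions of the first parents,
likewise for the second components, and a pair with equal parents receives one common draw.
Otherwise the dependence between the two systems is arbitrary. -/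
structure Mutation (m : Model X μ) (N : ℕ) [NeZero N] where
  kernel : ℕ → Kernel (Free N → X × X) (Free N → X × X)
  isMarkovKernel : ∀ t, IsMarkovKernel (kernel t)
  map_fst : ∀ t p, (kernel t p).map (fun q i => (q i).1) =
    Measure.pi fun i => m.trans t (p i).1
  map_snd : ∀ t p, (kernel t p).map (fun q i => (q i).2) =
    Measure.pi fun i => m.trans t (p i).2
  common : ∀ t p, ∀ᵐ q ∂(kernel t p), ∀ i, (p i).1 = (p i).2 → (q i).1 = (q i).2

instance (m : Model X μ) (N : ℕ) [NeZero N] (σ : Mutation m N) (t : ℕ) :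
    IsMarkovKernel (σ.kernel t) := σ.isMarkovKernel t

variable (X) in
/-- The two particle systems at one time: the pairs of particles `(X^{(i)}, X̃^{(i)})`, and the
two weight vectors. -/
abbrev State (N : ℕ) : Type u := (Fin N → X × X) × Weights N

variable {N : ℕ} [NeZero N]

/-- The pair `(x^{(a)}, x̃^{(b)})` selected by a pair of indices. -/
def select (x : Fin N → X × X) (a : Fin N × Fin N) : X × X := ((x a.1).1, (x a.2).2)

theorem measurable_select :
    Measurable fun p : (Fin N → X × X) × (Fin N × Fin N) => select p.1 p.2 := by
  refine measurable_from_prod_countable_left fun a => ?_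
  change Measurable fun x : Fin N → X × X => ((x a.1).1, (x a.2).2)
  fun_prop

/-- The reference pair at index `0`, and the pairs `q` at the other indices. -/
def withRef {Y : Type*} (r : Y) (q : Free N → Y) (i : Fin N) : Y :=
  if h : i = 0 then r else q ⟨i, h⟩

theorem measurable_withRef {Y : Type*} [MeasurableSpace Y] :
    Measurable fun p : Y × (Free N → Y) => withRef (N := N) p.1 p.2 := by
  refine measurable_pi_iff.mpr fun i => ?_
  unfold withRef
  split_ifs <;> fun_prop

/-- The state at the initial time, given the reference pair `r` and the free pairs. -/
def initState (m : Model X μ) (r : X × X) (x : Free N → X) : State X N :=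
  (withRef r fun i => (x i, x i),
    (fun i => m.G₁ (withRef r (fun i => (x i, x i)) i).1,
     fun i => m.G₁ (withRef r (fun i => (x i, x i)) i).2))

theorem measurable_initState (m : Model X μ) :
    Measurable fun p : (X × X) × (Free N → X) => initState (N := N) m p.1 p.2 := by
  have h : Measurable fun p : (X × X) × (Free N → X) =>
      withRef (N := N) p.1 fun i => (p.2 i, p.2 i) :=
    measurable_withRef.comp (f := fun p : (X × X) × (Free N → X) =>
      (p.1, fun i => (p.2 i, p.2 i))) (by fun_prop)
  have h' (i : Fin N) := (measurable_pi_iff.mp h) i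
  have hG := m.measurable_G₁
  unfold initState
  fun_prop

/-- The initial step: the free particles are common independent draws from `M₁`. -/
def initKernel (m : Model X μ) (N : ℕ) [NeZero N] : Kernel (X × X) (State X N) :=
  (Kernel.id ×ₖ Kernel.const (X × X) (Measure.pi fun _ : Free N => m.init)).map
    fun p => initState m p.1 p.2

instance (m : Model X μ) : IsMarkovKernel (initKernel m N) :=
  Kernel.IsMarkovKernel.map _ (measurable_initState m)

/-- The pairs of parents of the free particles, given their pairs of ancestor indices. -/
def parents (s : State X N) (a : Free N → Fin N × Fin N) (i : Free N) : X × X :=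
  select s.1 (a i)

theorem measurable_parents :
    Measurable fun p : State X N × (Free N → Fin N × Fin N) => parents p.1 p.2 := by
  refine measurable_pi_iff.mpr fun i => ?_
  exact measurable_select.comp (f := fun p : State X N × (Free N → Fin N × Fin N) =>
    (p.1.1, p.2 i)) (by fun_prop)

/-- The next state, given the next reference pair `r`, the current state `s`, the ancestor
indices `a` and the new free pairs `q`. The parent of the reference particle is the reference
particle. -/
def nextState (m : Model X μ) (t : ℕ) (r : X × X) (s : State X N)
    (a : Free N → Fin N × Fin N) (q : Free N → X × X) : State X N :=
  (withRef r q,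
    (fun i => m.G t (withRef (s.1 0) (parents s a) i).1 (withRef r q i).1,
     fun i => m.G t (withRef (s.1 0) (parents s a) i).2 (withRef r q i).2))

theorem measurable_nextState (m : Model X μ) (t : ℕ) :
    Measurable fun p : ((X × X) × State X N) × ((Free N → Fin N × Fin N) × (Free N → X × X)) =>
      nextState m t p.1.1 p.1.2 p.2.1 p.2.2 := by
  have h1 : Measurable fun p : ((X × X) × State X N) ×
      ((Free N → Fin N × Fin N) × (Free N → X × X)) => withRef (N := N) p.1.1 p.2.2 :=
    measurable_withRef.comp (f := fun p : ((X × X) × State X N) ×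
      ((Free N → Fin N × Fin N) × (Free N → X × X)) => (p.1.1, p.2.2)) (by fun_prop)
  have h2 : Measurable fun p : ((X × X) × State X N) ×
      ((Free N → Fin N × Fin N) × (Free N → X × X)) => parents p.1.2 p.2.1 :=
    measurable_parents.comp (f := fun p : ((X × X) × State X N) ×
      ((Free N → Fin N × Fin N) × (Free N → X × X)) => (p.1.2, p.2.1)) (by fun_prop)
  have h3 : Measurable fun p : ((X × X) × State X N) ×
      ((Free N → Fin N × Fin N) × (Free N → X × X)) =>
        withRef (N := N) (p.1.2.1 0) (parents p.1.2 p.2.1) :=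
    measurable_withRef.comp (f := fun p : ((X × X) × State X N) ×
      ((Free N → Fin N × Fin N) × (Free N → X × X)) =>
        (p.1.2.1 0, parents p.1.2 p.2.1)) (by fun_prop)
  have h1' (i : Fin N) := (measurable_pi_iff.mp h1) i
  have h3' (i : Fin N) := (measurable_pi_iff.mp h3) i
  have hG := m.measurable_G t
  refine h1.prodMk (Measurable.prodMk ?_ ?_)
  · exact measurable_pi_iff.mpr fun i => hG.comp ((h3' i).fst.prodMk (h1' i).fst)
  · exact measurable_pi_iff.mpr fun i => hG.comp ((h3' i).snd.prodMk (h1' i).snd)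

/-- One step of the forward pass, from index `t` to index `t + 1`, given the next reference
pair and the current state: coupled resampling, coupled mutation, weighting. -/
def stepKernel (m : Model X μ) (σ : Mutation m N) (t : ℕ) :
    Kernel ((X × X) × State X N) (State X N) :=
  (Kernel.id ×ₖ
    ((cresFree N).comap (fun p : (X × X) × State X N => p.2.2) (by fun_prop) ⊗ₖ
      (σ.kernel t).comap
        (fun p : ((X × X) × State X N) × (Free N → Fin N × Fin N) => parents p.1.2 p.2)
        (measurable_parents.comp (f := fun p : ((X × X) × State X N) ×
          (Free N → Fin N × Fin N) => (p.1.2, p.2)) (by fun_prop)))).map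
    fun p => nextState m t p.1.1 p.1.2 p.2.1 p.2.2

instance (m : Model X μ) (σ : Mutation m N) (t : ℕ) : IsMarkovKernel (stepKernel m σ t) :=
  Kernel.IsMarkovKernel.map _ (measurable_nextState m t)

theorem measurable_init {Y : Type*} [MeasurableSpace Y] (k : ℕ) :
    Measurable fun h : Fin (k + 1) → Y => (Fin.init h : Fin k → Y) :=
  measurable_pi_iff.mpr fun i => measurable_pi_apply i.castSucc

theorem measurable_snoc {Y : Type*} [MeasurableSpace Y] (k : ℕ) :
    Measurable fun p : (Fin k → Y) × Y => (Fin.snoc p.1 p.2 : Fin (k + 1) → Y) := by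
  refine measurable_pi_iff.mpr fun i => ?_
  refine Fin.lastCases ?_ (fun j => ?_) i
  · simpa using measurable_snd
  · simp only [Fin.snoc_castSucc]
    fun_prop

/-- The forward pass over the indices `0, …, k`, given the pairs of reference points: the law
of the sequence of states. -/
def forward (m : Model X μ) (σ : Mutation m N) :
    (k : ℕ) → Kernel (Fin (k + 1) → X × X) (Fin (k + 1) → State X N)
  | 0 => ((initKernel m N).comap (fun r : Fin 1 → X × X => r 0) (by fun_prop)).map
      fun s _ => s
  | k + 1 =>
    ((forward m σ k).comap (fun r : Fin (k + 2) → X × X => (Fin.init r : Fin (k + 1) → X × X))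
        (measurable_init (k + 1)) ⊗ₖ
      (stepKernel m σ k).comap
        (fun p : (Fin (k + 2) → X × X) × (Fin (k + 1) → State X N) =>
          (p.1 (Fin.last (k + 1)), p.2 (Fin.last k))) (by fun_prop)).map
      fun p => (Fin.snoc p.1 p.2 : Fin (k + 2) → State X N)

theorem isMarkovKernel_forward (m : Model X μ) (σ : Mutation m N) (k : ℕ) :
    IsMarkovKernel (forward m σ k) := by
  induction k with
  | zero => exact Kernel.IsMarkovKernel.map _ (by fun_prop)
  | succ k ih => exact Kernel.IsMarkovKernel.map _ (measurable_snoc (k + 1))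

instance (m : Model X μ) (σ : Mutation m N) (k : ℕ) : IsMarkovKernel (forward m σ k) :=
  isMarkovKernel_forward m σ k

/-- The backward sampling weights `(b, b̃)` at index `t`, for the state `s` at index `t` and the
pair `y` of points selected at index `t + 1`. -/
def backWeights (m : Model X μ) (t : ℕ) (s : State X N) (y : X × X) : Weights N :=
  (fun i => s.2.1 i * m.M t (s.1 i).1 y.1 * m.G t (s.1 i).1 y.1,
   fun i => s.2.2 i * m.M t (s.1 i).2 y.2 * m.G t (s.1 i).2 y.2)

theorem measurable_backWeights (m : Model X μ) (t : ℕ) :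
    Measurable fun p : State X N × (X × X) => backWeights m t p.1 p.2 := by
  have hM := m.measurable_M t
  have hG := m.measurable_G t
  refine Measurable.prodMk (measurable_pi_iff.mpr fun i => ?_)
    (measurable_pi_iff.mpr fun i => ?_)
  · have h : Measurable fun p : State X N × (X × X) => ((p.1.1 i).1, p.2.1) := by fun_prop
    exact ((by fun_prop : Measurable fun p : State X N × (X × X) => p.1.2.1 i).mul
      (hM.comp h)).mul (hG.comp h)
  · have h : Measurable fun p : State X N × (X × X) => ((p.1.1 i).2, p.2.2) := by fun_prop
    exact ((by fun_prop : Measurable fun p : State X N × (X × X) => p.1.2.2 i).mul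
      (hM.comp h)).mul (hG.comp h)

/-- The backward pass over the indices `k, …, 0`, given the states at the indices `0, …, k` and
the weights with which the pair of indices at index `k` is to be drawn: the law of the
selected pairs of points. -/
def backward (m : Model X μ) :
    (k : ℕ) → Kernel ((Fin (k + 1) → State X N) × Weights N) (Fin (k + 1) → X × X)
  | 0 =>
    (Kernel.id ×ₖ
      (cres N).comap (fun p : (Fin 1 → State X N) × Weights N => p.2) (by fun_prop)).map
      fun p _ => select (p.1.1 0).1 p.2
  | k + 1 =>
    ((Kernel.id ×ₖ
      (cres N).comap (fun p : (Fin (k + 2) → State X N) × Weights N => p.2) (by fun_prop)).map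
      fun p => select (p.1.1 (Fin.last (k + 1))).1 p.2) ⊗ₖ
      (backward m k).comap
        (fun p : ((Fin (k + 2) → State X N) × Weights N) × (X × X) =>
          ((Fin.init p.1.1 : Fin (k + 1) → State X N),
            backWeights m k (p.1.1 (Fin.last k).castSucc) p.2))
        (((measurable_init (k + 1)).comp (by fun_prop)).prodMk
          ((measurable_backWeights m k).comp
            (f := fun p : ((Fin (k + 2) → State X N) × Weights N) × (X × X) =>
              (p.1.1 (Fin.last k).castSucc, p.2)) (by fun_prop))) |>.map
      fun p => (Fin.snoc p.2 p.1 : Fin (k + 2) → X × X)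

theorem isMarkovKernel_backward (m : Model X μ) (k : ℕ) :
    IsMarkovKernel (backward (N := N) m k) := by
  induction k with
  | zero =>
    refine Kernel.IsMarkovKernel.map _ (measurable_pi_iff.mpr fun _ => ?_)
    exact measurable_select.comp (f := fun p : ((Fin 1 → State X N) × Weights N) ×
      (Fin N × Fin N) => ((p.1.1 0).1, p.2)) (by fun_prop)
  | succ k ih =>
    have : IsMarkovKernel ((Kernel.id ×ₖ
      (cres N).comap (fun p : (Fin (k + 2) → State X N) × Weights N => p.2) (by fun_prop)).map
      fun p => select (p.1.1 (Fin.last (k + 1))).1 p.2) :=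
      Kernel.IsMarkovKernel.map _ (measurable_select.comp
        (f := fun p : ((Fin (k + 2) → State X N) × Weights N) × (Fin N × Fin N) =>
          ((p.1.1 (Fin.last (k + 1))).1, p.2)) (by fun_prop))
    exact Kernel.IsMarkovKernel.map _ ((measurable_snoc (k + 1)).comp measurable_swap)

instance (m : Model X μ) (k : ℕ) : IsMarkovKernel (backward (N := N) m k) :=
  isMarkovKernel_backward m k

/-- The CCBPF transition on pairs of trajectories, stored as trajectories of pairs: the forward
pass over all times, then the backward pass started from the weights at the last time. For the
horizon `0` there is nothing to simulate. -/
def ccbpf (m : Model X μ) (σ : Mutation m N) : (T : ℕ) → Kernel (Fin T → X × X) (Fin T → X × X)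
  | 0 => Kernel.id
  | k + 1 =>
    ((backward m k).comap
      (fun h : Fin (k + 1) → State X N => (h, (h (Fin.last k)).2)) (by fun_prop)) ∘ₖ
      forward m σ k

instance (m : Model X μ) (σ : Mutation m N) (T : ℕ) : IsMarkovKernel (ccbpf m σ T) := by
  cases T <;> (unfold ccbpf; infer_instance)

/-- The law of the Markov chain `(S_k, S̃_k)`, `k = 0, 1, 2, …`, obtained by iterating CCBPF from
the reference trajectories `s` and `s'`. -/
def chain (m : Model X μ) (σ : Mutation m N) (T : ℕ) (s s' : Fin T → X) :
    Measure (ℕ → Fin T → X × X) :=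
  Kernel.traj (X := fun _ => Fin T → X × X)
    (fun n => (ccbpf m σ T).comap
      (fun h : (i : Finset.Iic n) → Fin T → X × X => h ⟨n, Finset.mem_Iic.mpr le_rfl⟩)
      (by fun_prop)) 0 (fun _ t => (s t, s' t))

/-- The coupling time `inf {k ≥ 1 : S_k = S̃_k}`, which is `⊤` if there is no such `k`. -/
def couplingTime {T : ℕ} (ω : ℕ → Fin T → X × X) : ℕ∞ :=
  ⨅ (k : ℕ) (_ : 1 ≤ k ∧ ∀ t, (ω k t).1 = (ω k t).2), (k : ℕ∞)

/-- The probability `P(τ ≥ n)` for the chain started from `(s, s')`. -/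
def tailProb (m : Model X μ) (σ : Mutation m N) (T : ℕ) (s s' : Fin T → X) (n : ℕ) : ℝ :=
  (chain m σ T s s').real {ω | (n : ℕ∞) ≤ couplingTime ω}

end Algorithm

end CCBPF

end

noncomputable section

namespace CCBPF

/-! ### The probability that index coupled resampling selects two different points -/

section Resampling

variable {N : ℕ}

/-! The proof shows that one CCBPF step contracts, in expectation, the weighted count of differences
`weightedDiff a r` = ∑ a^t 1{r_t differs}, by a factor that tends to 0 as N → ∞ and does not depend
on T.

Forward pass (`lintegral_forward_unmatched_le`). A free particle whose parents agree is matched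
again, in position and in weight, so new mismatches come only from the reference pair or from
drawing different parents. Balanced weights bound the probability of different parents by ε⁻¹ times
the unmatched proportion. Hence that proportion grows at most by the factor c = 2ε⁻¹ per step, and
each reference difference injects 1/N. Since a proportion never exceeds 1, a reference difference at
time i contributes at most min(1, c^n/N) at time i + n.

Backward pass (`lintegral_backward_weightedDiff_le`). If the points selected at t + 1 agree, those
selected at t differ with probability at most ε⁻¹ times the unmatched proportion. If they differ,
the weights still overlap by ε, up to unmatched particles, so a difference survives with probability
at most 1 - ε plus the same term. Going back one step changes the weight a^t by the factor a⁻¹, so a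
> 1 - ε makes the resulting geometric series converge, with sum A = a / (a - (1 - ε)).

Together the factor is `rate` = A ε⁻¹ ∑ a^n min(1, c^n/N). As a < 1, dominated convergence sends it
to 0 (`tendsto_rate`). Initially the weighted count is at most 1/(1 - a), and it is at least a^T as
long as the trajectories differ. Markov's inequality then bounds P(τ ≥ n + 1) by a^(-T) `rate`^n /
(1 - a); taking a > 1/α and N large gives the tail bound. -/

theorem lintegral_finKernel {A B : Type*} [MeasurableSpace A] [MeasurableSpace B] [Fintype B]
    [MeasurableSingletonClass B] (p : A → B → ℝ≥0) (hp : ∀ b, Measurable fun a => p a b) (a : A)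
    (f : B → ℝ≥0∞) : ∫⁻ b, f b ∂(finKernel p hp a) = ∑ b, (p a b : ℝ≥0∞) * f b := by
  change ∫⁻ b, f b ∂(∑ b, (p a b : ℝ≥0∞) • Measure.dirac b) = _
  simp [lintegral_finsetSum_measure, lintegral_smul_measure, lintegral_dirac]
  rfl

/-- A positive weight vector whose ratios are bounded below by `ε`. -/
def Balanced (ε : ℝ≥0) (ω : Fin N → ℝ≥0) : Prop :=
  (∀ i, 0 < ω i) ∧ ∀ i j, ε * ω i ≤ ω j

theorem Balanced.sum_pos [NeZero N] {ε : ℝ≥0} {ω : Fin N → ℝ≥0} (h : Balanced ε ω) :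
    0 < ∑ i, ω i :=
  Finset.sum_pos (fun i _ => h.1 i) Finset.univ_nonempty

theorem Balanced.nweight_eq [NeZero N] {ε : ℝ≥0} {ω : Fin N → ℝ≥0} (h : Balanced ε ω)
    (i : Fin N) : nweight ω i = ω i / ∑ j, ω j := by
  rw [nweight, if_neg h.sum_pos.ne']

theorem Balanced.le_nweight [NeZero N] {ε : ℝ≥0} {ω : Fin N → ℝ≥0} (h : Balanced ε ω)
    (i : Fin N) : ε / N ≤ nweight ω i := by
  have hN : (0 : ℝ≥0) < N := by exact_mod_cast Nat.pos_of_ne_zero (NeZero.ne N)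
  rw [h.nweight_eq, div_le_div_iff₀ hN h.sum_pos, Finset.mul_sum]
  calc ∑ j, ε * ω j ≤ ∑ _j : Fin N, ω i := Finset.sum_le_sum fun j _ => h.2 j i
    _ = ω i * N := by simp [mul_comm]

theorem Balanced.nweight_le [NeZero N] {ε : ℝ≥0} (hε : 0 < ε) {ω : Fin N → ℝ≥0}
    (h : Balanced ε ω) (i : Fin N) : nweight ω i ≤ 1 / (ε * N) := by
  have hN : (0 : ℝ≥0) < N := by exact_mod_cast Nat.pos_of_ne_zero (NeZero.ne N)
  rw [h.nweight_eq, div_le_div_iff₀ h.sum_pos (by positivity), one_mul]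
  calc ω i * (ε * N) = ∑ _j : Fin N, ε * ω i := by simp; ring
    _ ≤ ∑ j, ω j := Finset.sum_le_sum fun j _ => h.2 i j

theorem Balanced.mul_card_le_sum_min [NeZero N] {ε : ℝ≥0} {ω ω' : Fin N → ℝ≥0}
    (h : Balanced ε ω) (h' : Balanced ε ω') (K : Finset (Fin N)) :
    ε * (K.card / N) ≤ ∑ i ∈ K, min (nweight ω i) (nweight ω' i) := by
  calc ε * (K.card / N) = ∑ _i ∈ K, ε / N := by simp; ring
    _ ≤ _ := Finset.sum_le_sum fun i _ => le_min (h.le_nweight i) (h'.le_nweight i)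

/-- Off `K` the raw weights agree, so there the vector with the larger total has the smaller
normalised weights. The minimum off `K` is therefore its whole mass off `K`, and balance bounds the
mass it puts on `K`. -/
theorem Balanced.one_le_sum_min_add_of_sum_le [NeZero N] {ε : ℝ≥0} (hε : 0 < ε)
    {ω ω' : Fin N → ℝ≥0} (h : Balanced ε ω) (h' : Balanced ε ω') (K : Finset (Fin N))
    (hK : ∀ i ∉ K, ω i = ω' i) (hle : ∑ i, ω' i ≤ ∑ i, ω i) :
    1 ≤ ∑ i ∈ Kᶜ, min (nweight ω i) (nweight ω' i) + K.card / (ε * N) := by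
  have h1 : ∑ i ∈ Kᶜ, min (nweight ω i) (nweight ω' i) = ∑ i ∈ Kᶜ, nweight ω i := by
    refine Finset.sum_congr rfl fun i hi => min_eq_left ?_
    rw [h.nweight_eq, h'.nweight_eq, hK i (Finset.mem_compl.mp hi)]
    exact div_le_div_of_nonneg_left zero_le h'.sum_pos hle
  have h2 : ∑ i ∈ K, nweight ω i ≤ K.card / (ε * N) := by
    calc ∑ i ∈ K, nweight ω i ≤ ∑ _i ∈ K, 1 / (ε * N) :=
          Finset.sum_le_sum fun i _ => h.nweight_le hε i
      _ = _ := by simp [div_eq_mul_inv, mul_comm]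
  rw [h1, ← sum_nweight ω, ← Finset.sum_compl_add_sum K]
  gcongr

theorem Balanced.one_le_sum_min_add [NeZero N] {ε : ℝ≥0} (hε : 0 < ε)
    {ω ω' : Fin N → ℝ≥0} (h : Balanced ε ω) (h' : Balanced ε ω') (K : Finset (Fin N))
    (hK : ∀ i ∉ K, ω i = ω' i) :
    1 ≤ ∑ i ∈ Kᶜ, min (nweight ω i) (nweight ω' i) + K.card / (ε * N) := by
  rcases le_total (∑ i, ω' i) (∑ i, ω i) with hle | hle
  · exact h.one_le_sum_min_add_of_sum_le hε h' K hK hle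
  · simp_rw [fun i => min_comm (nweight ω i) (nweight ω' i)]
    exact h'.one_le_sum_min_add_of_sum_le hε h K (fun i hi => (hK i hi).symm) hle

/-- Meant for `f` the indicator of selecting different points: each common draw of an index outside
`K` has mass at least the overlap of the two weights there, and on it `f` vanishes. -/
theorem sum_cresMass_mul_add_le [NeZero N] (ω ω' : Fin N → ℝ≥0) (f : Fin N × Fin N → ℝ≥0)
    (hf : ∀ a, f a ≤ 1) (K : Finset (Fin N)) (hK : ∀ i ∉ K, f (i, i) = 0) :
    ∑ a, cresMass ω ω' a * f a + ∑ i ∈ Kᶜ, min (nweight ω i) (nweight ω' i) ≤ 1 := by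
  have h1 : ∑ i ∈ Kᶜ, min (nweight ω i) (nweight ω' i) = ∑ a : Fin N × Fin N,
      if a.1 = a.2 then (if a.1 ∈ Kᶜ then min (nweight ω a.1) (nweight ω' a.1) else 0)
        else 0 := by
    rw [Fintype.sum_prod_type]
    simp only [Finset.sum_ite_eq, Finset.mem_univ, if_true]
    rw [← Finset.sum_filter, Finset.filter_mem_eq_inter, Finset.univ_inter]
  rw [h1, ← Finset.sum_add_distrib, ← sum_cresMass ω ω']
  refine Finset.sum_le_sum fun a _ => ?_
  obtain ⟨i, j⟩ := a
  dsimp only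
  split_ifs with hij hi
  · subst hij
    rw [hK i (Finset.mem_compl.mp hi), mul_zero, zero_add, cresMass, ← pc_mul_wc]
    simp
  · rw [add_zero]
    exact mul_le_of_le_one_right' (hf _)
  · rw [add_zero]
    exact mul_le_of_le_one_right' (hf _)

end Resampling

/-! ### Disagreement of the selected points -/

section Difference

variable {X : Type u}

open Classical in
/-- The indicator of the pairs of different points. -/
def diff (p : X × X) : ℝ≥0∞ := if p.1 = p.2 then 0 else 1

theorem diff_of_eq {p : X × X} (h : p.1 = p.2) : diff p = 0 := if_pos h

theorem diff_of_ne {p : X × X} (h : p.1 ≠ p.2) : diff p = 1 := if_neg h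

theorem diff_le_one (p : X × X) : diff p ≤ 1 := by
  unfold diff; split_ifs <;> simp

theorem measurable_diff [MeasurableSpace X] [MeasurableEq X] : Measurable (diff : X × X → ℝ≥0∞) := by
  classical
  exact Measurable.ite measurableSet_diagonal measurable_const measurable_const

theorem lintegral_cres {N : ℕ} (w : Weights N) (f : Fin N × Fin N → ℝ≥0∞) :
    ∫⁻ a, f a ∂(cres N w) = ∑ a, (cresMass w.1 w.2 a : ℝ≥0∞) * f a :=
  lintegral_finKernel _ _ _ _

variable {N : ℕ} [NeZero N]

/-- The probability that a draw from `CRes` selects two different points. -/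
def selectDiff (x : Fin N → X × X) (w : Weights N) : ℝ≥0∞ :=
  ∑ a, (cresMass w.1 w.2 a : ℝ≥0∞) * diff (select x a)

theorem selectDiff_add_le (x : Fin N → X × X) (w : Weights N) (K : Finset (Fin N))
    (hK : ∀ i ∉ K, (x i).1 = (x i).2) :
    selectDiff x w + ((∑ i ∈ Kᶜ, min (nweight w.1 i) (nweight w.2 i) : ℝ≥0) : ℝ≥0∞) ≤ 1 := by
  classical
  have h := sum_cresMass_mul_add_le w.1 w.2
    (fun a => if (select x a).1 = (select x a).2 then 0 else 1)
    (fun a => by split_ifs <;> simp) K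
    (fun i hi => if_pos (hK i hi))
  have h' := ENNReal.coe_le_coe.mpr h
  rw [ENNReal.coe_add] at h'
  convert! h' using 2
  rw [selectDiff, ENNReal.ofNNReal_finsetSum]
  refine Finset.sum_congr rfl fun a _ => ?_
  rw [ENNReal.coe_mul, diff]
  congr 1
  split_ifs <;> simp

/-- The good regime: outside `K` points and weights both agree, so the failure probability is of the
order of the proportion of `K`. -/
theorem selectDiff_le_of_weights_eq {ε : ℝ≥0} (hε : 0 < ε) (x : Fin N → X × X) (w : Weights N)
    (h : Balanced ε w.1) (h' : Balanced ε w.2) (K : Finset (Fin N))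
    (hK : ∀ i ∉ K, (x i).1 = (x i).2) (hw : ∀ i ∉ K, w.1 i = w.2 i) :
    selectDiff x w ≤ (ε : ℝ≥0∞)⁻¹ * (K.card / N) := by
  have h1 := selectDiff_add_le x w K hK
  have h2 := ENNReal.coe_le_coe.mpr (h.one_le_sum_min_add hε h' K hw)
  set S := ∑ i ∈ Kᶜ, min (nweight w.1 i) (nweight w.2 i)
  have hN : (N : ℝ≥0) ≠ 0 := by exact_mod_cast NeZero.ne N
  have h3 : (((K.card / (ε * N) : ℝ≥0)) : ℝ≥0∞) = (ε : ℝ≥0∞)⁻¹ * (K.card / N) := by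
    rw [← ENNReal.coe_inv hε.ne', ← ENNReal.coe_natCast, ← ENNReal.coe_natCast N,
      ← ENNReal.coe_div hN, ← ENNReal.coe_mul]
    congr 1
    field_simp
  rw [ENNReal.coe_add, h3, ENNReal.coe_one] at h2
  have h4 : selectDiff x w + S ≤ (ε : ℝ≥0∞)⁻¹ * (K.card / N) + S := by
    rw [add_comm _ (S : ℝ≥0∞)] at h1 ⊢
    rw [add_comm _ (S : ℝ≥0∞)]
    exact h1.trans h2
  exact (ENNReal.add_le_add_iff_right ENNReal.coe_ne_top).mp h4

/-- The bad regime: outside `K` only the points agree. Any two balanced vectors still overlap by ε/N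
at every index, which leaves a probability about ε of coupling. -/
theorem selectDiff_le {ε : ℝ≥0} (hε : ε ≤ 1) (x : Fin N → X × X) (w : Weights N)
    (h : Balanced ε w.1) (h' : Balanced ε w.2) (K : Finset (Fin N))
    (hK : ∀ i ∉ K, (x i).1 = (x i).2) :
    selectDiff x w ≤ (1 - ε : ℝ≥0) + K.card / N := by
  have h1 := selectDiff_add_le x w K hK
  have h2 := h.mul_card_le_sum_min h' Kᶜ
  set S := ∑ i ∈ Kᶜ, min (nweight w.1 i) (nweight w.2 i)
  have hN : (N : ℝ≥0) ≠ 0 := by exact_mod_cast NeZero.ne N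
  have h3 : (1 : ℝ≥0) ≤ (1 - ε) + K.card / N + S := by
    have h5 : ((Kᶜ.card : ℝ≥0) / N) + K.card / N = 1 := by
      rw [← add_div, ← Nat.cast_add, Finset.card_compl_add_card, Fintype.card_fin, div_self hN]
    calc (1 : ℝ≥0) = (1 - ε) + ε * ((Kᶜ.card : ℝ≥0) / N + K.card / N) := by
          rw [h5, mul_one, tsub_add_cancel_of_le hε]
      _ = (1 - ε) + ε * (K.card / N) + ε * (Kᶜ.card / N) := by ring
      _ ≤ _ := by
          gcongr
          exact mul_le_of_le_one_left' hε
  have h4 : selectDiff x w + S ≤ ((1 - ε : ℝ≥0) + K.card / N) + S := by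
    refine h1.trans ?_
    have := ENNReal.coe_le_coe.mpr h3
    rw [ENNReal.coe_add, ENNReal.coe_add, ENNReal.coe_div hN] at this
    simpa using this
  exact (ENNReal.add_le_add_iff_right ENNReal.coe_ne_top).mp h4

end Difference

/-! ### Unmatched particles in the forward pass -/

section Unmatched

variable {X : Type u} {N : ℕ}

open Classical in
/-- The indices of the particles that differ, in position or in weight, between both systems. -/
def unmatchedSet (s : State X N) : Finset (Fin N) :=
  {i | ¬ ((s.1 i).1 = (s.1 i).2 ∧ s.2.1 i = s.2.2 i)}

theorem not_mem_unmatchedSet {s : State X N} {i : Fin N} :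
    i ∉ unmatchedSet s ↔ (s.1 i).1 = (s.1 i).2 ∧ s.2.1 i = s.2.2 i := by
  simp [unmatchedSet]

theorem card_unmatchedSet_eq_sum [NeZero N] (s : State X N) :
    ((unmatchedSet s).card : ℝ≥0∞) =
      (if (0 : Fin N) ∈ unmatchedSet s then 1 else 0) +
      ∑ i : Free N, if i.1 ∈ unmatchedSet s then 1 else 0 := by
  classical
  rw [Finset.card_eq_sum_ones, ← Finset.univ_inter (unmatchedSet s), ← Finset.filter_mem_eq_inter,
    Finset.sum_filter, Nat.cast_sum]
  simp only [Nat.cast_ite, Nat.cast_one, Nat.cast_zero, Finset.filter_mem_eq_inter,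
    Finset.univ_inter]
  rw [← Finset.add_sum_erase _ _ (Finset.mem_univ (0 : Fin N))]
  congr 1
  refine (Finset.sum_subtype _ (fun i => ?_) _)
  simp

theorem card_div_le_one (K : Finset (Fin N)) : ((K.card : ℝ≥0∞) / N) ≤ 1 := by
  refine ENNReal.div_le_of_le_mul ?_
  rw [one_mul]
  exact_mod_cast (Finset.card_le_univ K).trans_eq (Fintype.card_fin N)

theorem sum_prod_mul_apply {ι B : Type*} [Fintype ι] [DecidableEq ι] [Fintype B]
    (p : B → ℝ≥0∞)
    (hp : ∑ b, p b = 1) (f : B → ℝ≥0∞) (i : ι) :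
    ∑ a : ι → B, (∏ j, p (a j)) * f (a i) = ∑ b, p b * f b := by
  classical
  -- Distributivity, with `f` inserted into the `i`-th factor only; the other factors sum to 1.
  have h := Finset.prod_univ_sum (fun _ : ι => (Finset.univ : Finset B))
    (fun j b => p b * if j = i then f b else 1)
  rw [Fintype.piFinset_univ] at h
  simp only [Finset.prod_mul_distrib, Finset.prod_ite_eq', Finset.mem_univ, if_true] at h
  rw [← h, ← Finset.mul_prod_erase _ _ (Finset.mem_univ i), Finset.prod_eq_one, mul_one]
  · simp
  · intro j hj
    simp [Finset.ne_of_mem_erase hj, hp]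

end Unmatched

/-! ### Strong mixing and one forward step -/

section Mixing

variable {X : Type u} [MeasurableSpace X] {μ : Measure X} {m : Model X μ} {T : ℕ} {ε : ℝ≥0}

theorem Model.mul_Gsup_le (he : (ε : ℝ≥0∞) ≤ m.epsConst T) {t : ℕ} (ht : t < T) :
    ε * m.Gsup t ≤ m.Ginf t := by
  refine ENNReal.mul_le_of_le_div (he.trans ((min_le_left _ _).trans ?_))
  exact iInf₂_le t ht

theorem Model.mul_sup_le (he : (ε : ℝ≥0∞) ≤ m.epsConst T) {t : ℕ} (ht : t + 1 < T) :
    ε * (m.Gsup t * m.Msup t * m.Gsup (t + 1)) ≤ m.Ginf t * m.Minf t * m.Ginf (t + 1) := by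
  refine ENNReal.mul_le_of_le_div (he.trans ((min_le_right _ _).trans ?_))
  exact iInf₂_le t ht

theorem balanced_of_bounds {N : ℕ} {ω : Fin N → ℝ≥0} {lo hi : ℝ≥0∞} (hlo : 0 < lo)
    (h : ε * hi ≤ lo) (hω : ∀ i, lo ≤ ω i ∧ ω i ≤ hi) : Balanced ε ω := by
  refine ⟨fun i => ?_, fun i j => ?_⟩
  · exact_mod_cast hlo.trans_le (hω i).1
  · have : (ε : ℝ≥0∞) * ω i ≤ ω j := by
      refine le_trans ?_ (h.trans (hω j).1)
      gcongr
      exact (hω i).2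
    exact_mod_cast this

/-- Both weight vectors are within the bounds of the potential at index `t`. -/
def InRange {N : ℕ} (m : Model X μ) (t : ℕ) (s : State X N) : Prop :=
  ∀ i, (m.Ginf t ≤ s.2.1 i ∧ s.2.1 i ≤ m.Gsup t) ∧ (m.Ginf t ≤ s.2.2 i ∧ s.2.2 i ≤ m.Gsup t)

theorem measurableSet_inRange {N : ℕ} (m : Model X μ) (t : ℕ) :
    MeasurableSet {s : State X N | InRange m t s} := by
  simp only [InRange, Set.ofPred_forall]
  refine MeasurableSet.iInter fun i => ?_
  have h1 : Measurable fun s : State X N => (s.2.1 i : ℝ≥0∞) := by fun_prop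
  have h2 : Measurable fun s : State X N => (s.2.2 i : ℝ≥0∞) := by fun_prop
  exact ((measurableSet_le measurable_const h1).inter
    (measurableSet_le h1 measurable_const)).inter
    ((measurableSet_le measurable_const h2).inter (measurableSet_le h2 measurable_const))

theorem InRange.balanced {N : ℕ} {t : ℕ} {s : State X N} (h : InRange m t s)
    (hm : m.StrongMixing T) (he : (ε : ℝ≥0∞) ≤ m.epsConst T) (ht : t < T) :
    Balanced ε s.2.1 ∧ Balanced ε s.2.2 :=
  ⟨balanced_of_bounds (hm.1 t ht).1 (m.mul_Gsup_le he ht) fun i => (h i).1,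
    balanced_of_bounds (hm.1 t ht).1 (m.mul_Gsup_le he ht) fun i => (h i).2⟩

theorem Model.G_bounds (m : Model X μ) (t : ℕ) (x y : X) :
    m.Ginf (t + 1) ≤ m.G t x y ∧ (m.G t x y : ℝ≥0∞) ≤ m.Gsup (t + 1) :=
  ⟨iInf₂_le (f := fun x y => (m.G t x y : ℝ≥0∞)) x y,
    le_iSup₂ (f := fun x y => (m.G t x y : ℝ≥0∞)) x y⟩

theorem Model.M_bounds (m : Model X μ) (t : ℕ) (x y : X) :
    m.Minf t ≤ m.M t x y ∧ (m.M t x y : ℝ≥0∞) ≤ m.Msup t :=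
  ⟨iInf₂_le (f := fun x y => (m.M t x y : ℝ≥0∞)) x y,
    le_iSup₂ (f := fun x y => (m.M t x y : ℝ≥0∞)) x y⟩

theorem InRange.balanced_backWeights {N : ℕ} {t : ℕ} {s : State X N} (h : InRange m t s)
    (hm : m.StrongMixing T) (he : (ε : ℝ≥0∞) ≤ m.epsConst T) (ht : t + 1 < T) (y : X × X) :
    Balanced ε (backWeights m t s y).1 ∧ Balanced ε (backWeights m t s y).2 := by
  have hpos : 0 < m.Ginf t * m.Minf t * m.Ginf (t + 1) :=
    ENNReal.mul_pos (ENNReal.mul_pos (hm.1 t (by omega)).1.ne' (hm.2 t ht).1.ne').ne'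
      (hm.1 (t + 1) ht).1.ne'
  refine ⟨balanced_of_bounds hpos (m.mul_sup_le he ht) fun i => ?_,
    balanced_of_bounds hpos (m.mul_sup_le he ht) fun i => ?_⟩
  · simp only [backWeights, ENNReal.coe_mul]
    exact ⟨mul_le_mul' (mul_le_mul' (h i).1.1 (m.M_bounds t _ _).1) (m.G_bounds t _ _).1,
      mul_le_mul' (mul_le_mul' (h i).1.2 (m.M_bounds t _ _).2) (m.G_bounds t _ _).2⟩
  · simp only [backWeights, ENNReal.coe_mul]
    exact ⟨mul_le_mul' (mul_le_mul' (h i).2.1 (m.M_bounds t _ _).1) (m.G_bounds t _ _).1,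
      mul_le_mul' (mul_le_mul' (h i).2.2 (m.M_bounds t _ _).2) (m.G_bounds t _ _).2⟩

open Classical in
/-- The proportion of unmatched particles, infinite if the weights are out of range. -/
def unmatched {N : ℕ} (m : Model X μ) (t : ℕ) (s : State X N) : ℝ≥0∞ :=
  if InRange m t s then (unmatchedSet s).card / N else ∞

theorem unmatched_of_inRange {N : ℕ} {t : ℕ} {s : State X N} (h : InRange m t s) :
    unmatched m t s = (unmatchedSet s).card / N := if_pos h

theorem measurable_unmatched {N : ℕ} [MeasurableEq X] (m : Model X μ) (t : ℕ) :
    Measurable (unmatched (N := N) m t) := by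
  classical
  refine Measurable.ite (measurableSet_inRange m t) ?_ measurable_const
  simp only [unmatchedSet, Finset.card_filter, Nat.cast_sum]
  refine Measurable.div_const (Finset.measurable_sum _ fun i _ => ?_) _
  simp only [Nat.cast_ite]
  refine Measurable.ite (MeasurableSet.compl (MeasurableSet.inter ?_ ?_))
    measurable_const measurable_const
  · exact measurableSet_eq_fun (by fun_prop) (by fun_prop)
  · exact measurableSet_eq_fun (by fun_prop) (by fun_prop)

theorem unmatched_le_one {N : ℕ} {t : ℕ} {s : State X N} (h : InRange m t s) :
    unmatched m t s ≤ 1 := by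
  rw [unmatched_of_inRange h]
  exact card_div_le_one _

variable {N : ℕ} [NeZero N]

theorem inRange_initState (m : Model X μ) (r : X × X) (x : Free N → X) :
    InRange m 0 (initState m r x) := fun _ =>
  ⟨⟨iInf_le (fun x => (m.G₁ x : ℝ≥0∞)) _, le_iSup (fun x => (m.G₁ x : ℝ≥0∞)) _⟩,
    ⟨iInf_le (fun x => (m.G₁ x : ℝ≥0∞)) _, le_iSup (fun x => (m.G₁ x : ℝ≥0∞)) _⟩⟩

theorem inRange_nextState (m : Model X μ) (t : ℕ) (r : X × X) (s : State X N)
    (a : Free N → Fin N × Fin N) (q : Free N → X × X) :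
    InRange m (t + 1) (nextState m t r s a q) := fun _ =>
  ⟨m.G_bounds t _ _, m.G_bounds t _ _⟩

theorem card_unmatchedSet_initState_le (m : Model X μ) (r : X × X) (x : Free N → X) :
    ((unmatchedSet (initState m r x)).card : ℝ≥0∞) ≤ diff r := by
  rw [card_unmatchedSet_eq_sum, Finset.sum_eq_zero, add_zero]
  · by_cases h : r.1 = r.2
    · rw [if_neg]
      · exact zero_le
      · rw [not_mem_unmatchedSet]
        simp [initState, withRef, h]
    · rw [diff_of_ne h]
      split_ifs <;> simp
  · intro i _
    rw [if_neg]
    rw [not_mem_unmatchedSet]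
    simp [initState, withRef, i.2]

/-- The new weight depends only on parent and child. A free particle with equal parents is thus
matched, while the reference particle is matched if its new points agree and its current points,
which are its parents, agree too. -/
theorem card_unmatchedSet_nextState_le (m : Model X μ) (t : ℕ) (r : X × X) (s : State X N)
    (a : Free N → Fin N × Fin N) (q : Free N → X × X)
    (hq : ∀ i, (parents s a i).1 = (parents s a i).2 → (q i).1 = (q i).2) :
    ((unmatchedSet (nextState m t r s a q)).card : ℝ≥0∞) ≤
      diff r + (unmatchedSet s).card + ∑ i, diff (parents s a i) := by
  rw [card_unmatchedSet_eq_sum (nextState m t r s a q)]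
  refine add_le_add ?_ (Finset.sum_le_sum fun i _ => ?_)
  · by_cases h : r.1 = r.2
    · by_cases h0 : (0 : Fin N) ∈ unmatchedSet s
      · have : (1 : ℝ≥0∞) ≤ (unmatchedSet s).card := by
          -- The reference index is itself unmatched, so the whole current count is at least 1 and
          -- pays for it.
          exact_mod_cast Finset.card_pos.mpr ⟨0, h0⟩
        refine le_trans ?_ (this.trans le_add_self)
        split_ifs <;> simp
      · rw [if_neg]
        · exact zero_le
        · rw [not_mem_unmatchedSet] at h0 ⊢
          simp [nextState, withRef, h, h0.1]
    · rw [diff_of_ne h, add_comm]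
      refine le_trans ?_ le_add_self
      split_ifs <;> simp
  · by_cases h : (parents s a i).1 = (parents s a i).2
    · rw [if_neg]
      · exact zero_le
      · rw [not_mem_unmatchedSet]
        simp [nextState, withRef, i.2, h, hq i h]
    · rw [diff_of_ne h]
      split_ifs <;> simp

theorem lintegral_cresFree_apply (w : Weights N) (f : Fin N × Fin N → ℝ≥0∞) (i : Free N) :
    ∫⁻ a, f (a i) ∂(cresFree N w) = ∑ a, (cresMass w.1 w.2 a : ℝ≥0∞) * f a := by
  rw [cresFree, lintegral_finKernel]
  simp only [ENNReal.ofNNReal_finsetProd]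
  refine sum_prod_mul_apply (fun a => (cresMass w.1 w.2 a : ℝ≥0∞)) ?_ f i
  exact_mod_cast sum_cresMass w.1 w.2

theorem lintegral_stepKernel (m : Model X μ) (σ : Mutation m N) (t : ℕ) (r : X × X)
    (s : State X N) {f : State X N → ℝ≥0∞} (hf : Measurable f) :
    ∫⁻ s', f s' ∂(stepKernel m σ t (r, s)) =
      ∫⁻ a, ∫⁻ q, f (nextState m t r s a q) ∂(σ.kernel t (parents s a)) ∂(cresFree N s.2) := by
  have h : Measurable fun p : ((X × X) × State X N) ×
      ((Free N → Fin N × Fin N) × (Free N → X × X)) => f (nextState m t p.1.1 p.1.2 p.2.1 p.2.2) :=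
    hf.comp (measurable_nextState m t)
  rw [stepKernel, Kernel.lintegral_map _ (measurable_nextState m t) _ hf,
    Kernel.lintegral_id_prod h, Kernel.lintegral_compProd]
  · rfl
  · exact h.comp (by fun_prop)

theorem selectDiff_self_le (hm : m.StrongMixing T) (hε : 0 < ε)
    (he : (ε : ℝ≥0∞) ≤ m.epsConst T) {t : ℕ} (ht : t < T) (s : State X N) :
    selectDiff s.1 s.2 ≤ (ε : ℝ≥0∞)⁻¹ * unmatched m t s := by
  by_cases hs : InRange m t s
  · rw [unmatched_of_inRange hs]
    obtain ⟨h1, h2⟩ := hs.balanced hm he ht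
    exact selectDiff_le_of_weights_eq hε _ _ h1 h2 _ (fun i hi => (not_mem_unmatchedSet.mp hi).1)
      (fun i hi => (not_mem_unmatchedSet.mp hi).2)
  -- Out of range the right-hand side is infinite; this convention makes the bound valid for every
  -- state instead of almost surely.
  · rw [unmatched, if_neg hs, ENNReal.mul_top (by simp)]
    exact le_top

variable [MeasurableEq X]

theorem lintegral_initKernel_le (m : Model X μ) (r : X × X) :
    ∫⁻ s, unmatched m 0 s ∂(initKernel m N r) ≤ min 1 (diff r / N) := by
  have h : Measurable fun p : (X × X) × (Free N → X) => unmatched m 0 (initState m p.1 p.2) :=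
    (measurable_unmatched m 0).comp (measurable_initState m)
  rw [initKernel, Kernel.lintegral_map _ (measurable_initState m) _ (measurable_unmatched m 0),
    Kernel.lintegral_id_prod h]
  refine (lintegral_mono (g := fun _ => min 1 (diff r / N)) fun x => ?_).trans (by simp)
  refine le_min (unmatched_le_one (inRange_initState m _ _)) ?_
  dsimp only
  rw [unmatched_of_inRange (inRange_initState m _ _)]
  gcongr
  exact card_unmatchedSet_initState_le m r x

theorem lintegral_stepKernel_unmatched_le_one (m : Model X μ) (σ : Mutation m N) (t : ℕ)
    (r : X × X) (s : State X N) :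
    ∫⁻ s', unmatched m (t + 1) s' ∂(stepKernel m σ t (r, s)) ≤ 1 := by
  rw [lintegral_stepKernel m σ t r s (measurable_unmatched m (t + 1))]
  refine (lintegral_mono (g := fun _ => 1) fun a => ?_).trans (by simp)
  refine (lintegral_mono (g := fun _ => 1) fun q => ?_).trans (by simp)
  exact unmatched_le_one (inRange_nextState m t r s a q)

/-- The factor 2 collects two contributions: the parent of the reference particle may be unmatched,
and each of the fewer than N free particles draws different parents with probability at most ε⁻¹
times the unmatched proportion. -/
theorem lintegral_stepKernel_unmatched_le (hm : m.StrongMixing T) (hε : 0 < ε) (hε1 : ε ≤ 1)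
    (he : (ε : ℝ≥0∞) ≤ m.epsConst T) (σ : Mutation m N) {t : ℕ} (ht : t < T) (r : X × X)
    (s : State X N) :
    ∫⁻ s', unmatched m (t + 1) s' ∂(stepKernel m σ t (r, s)) ≤
      diff r / N + 2 * (ε : ℝ≥0∞)⁻¹ * unmatched m t s := by
  have hNt : (N : ℝ≥0∞) ≠ ∞ := ENNReal.natCast_ne_top N
  have hN0 : (N : ℝ≥0∞) ≠ 0 := by exact_mod_cast NeZero.ne N
  by_cases hs : InRange m t s
  swap
  · have : unmatched m t s = ∞ := if_neg hs
    rw [this, ENNReal.mul_top (by simp)]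
    simp
  rw [lintegral_stepKernel m σ t r s (measurable_unmatched m (t + 1))]
  have h1 (a : Free N → Fin N × Fin N) :
      ∫⁻ q, unmatched m (t + 1) (nextState m t r s a q) ∂(σ.kernel t (parents s a)) ≤
        (diff r + (unmatchedSet s).card + ∑ i, diff (parents s a i)) / N := by
    refine (lintegral_mono_ae (g := fun _ =>
      (diff r + (unmatchedSet s).card + ∑ i, diff (parents s a i)) / N) ?_).trans (by simp)
    filter_upwards [σ.common t (parents s a)] with q hq
    rw [unmatched_of_inRange (inRange_nextState m t r s a q)]
    gcongr
    exact card_unmatchedSet_nextState_le m t r s a q hq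
  refine (lintegral_mono h1).trans ?_
  simp only [div_eq_mul_inv]
  rw [lintegral_mul_const _ (measurable_of_finite _), lintegral_add_left measurable_const,
    lintegral_finsetSum _ (fun i _ => measurable_of_finite _)]
  have h2 (i : Free N) : ∫⁻ a, diff (parents s a i) ∂(cresFree N s.2) = selectDiff s.1 s.2 :=
    lintegral_cresFree_apply s.2 (fun a => diff (select s.1 a)) i
  simp only [h2, lintegral_const, measure_univ, mul_one, Finset.sum_const, nsmul_eq_mul]
  have h3 : ((Finset.univ : Finset (Free N)).card : ℝ≥0∞) ≤ N := by
    have : Fintype.card (Free N) ≤ N := by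
      simp
    exact_mod_cast this
  have hu : ((unmatchedSet s).card : ℝ≥0∞) * (N : ℝ≥0∞)⁻¹ = unmatched m t s :=
    (unmatched_of_inRange hs).symm
  have hone : (1 : ℝ≥0∞) ≤ (ε : ℝ≥0∞)⁻¹ := by
    rw [ENNReal.one_le_inv]
    exact_mod_cast hε1
  calc (diff r + (unmatchedSet s).card + _ * selectDiff s.1 s.2) * (N : ℝ≥0∞)⁻¹
      ≤ (diff r + (unmatchedSet s).card + N * selectDiff s.1 s.2) * (N : ℝ≥0∞)⁻¹ := by gcongr
    _ = diff r * (N : ℝ≥0∞)⁻¹ + unmatched m t s + selectDiff s.1 s.2 := by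
        rw [add_mul, add_mul, hu, mul_comm (N : ℝ≥0∞), mul_assoc,
          ENNReal.mul_inv_cancel hN0 hNt, mul_one]
    _ ≤ diff r * (N : ℝ≥0∞)⁻¹ + (ε : ℝ≥0∞)⁻¹ * unmatched m t s +
          (ε : ℝ≥0∞)⁻¹ * unmatched m t s := by
        gcongr
        · exact le_mul_of_one_le_left' hone
        · exact selectDiff_self_le hm hε he ht s
    _ = _ := by ring

end Mixing

/-! ### Propagation of unmatched particles along the forward pass -/

section Spread

/-- The bound on the proportion of particles that remain unmatched `n` steps after one reference
pair of different points. -/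
def spread (c : ℝ≥0∞) (N n : ℕ) : ℝ≥0∞ := min 1 (c ^ n / N)

/-- Subadditivity lets the cap at 1 on the total proportion be applied to the contribution of each
reference difference separately. -/
theorem min_one_sum_le {ι : Type*} (s : Finset ι) (f : ι → ℝ≥0∞) :
    min 1 (∑ i ∈ s, f i) ≤ ∑ i ∈ s, min 1 (f i) := by
  classical
  induction s using Finset.induction_on with
  | empty => simp
  | insert i s hi ih =>
    rw [Finset.sum_insert hi, Finset.sum_insert hi]
    refine le_trans ?_ (add_le_add_right ih _)
    rcases le_total 1 (f i) with h | h
    · simp [h]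
    · rcases le_total 1 (∑ i ∈ s, f i) with h' | h'
      · rw [min_eq_left h']
        exact (min_le_left _ _).trans le_add_self
      · rw [min_eq_right h, min_eq_right h']
        exact min_le_right _ _

theorem sum_conv_le (T : ℕ) (f g : ℕ → ℝ≥0∞) :
    ∑ t ∈ Finset.range T, ∑ i ∈ Finset.range (t + 1), f i * g (t - i) ≤
      (∑ i ∈ Finset.range T, f i) * ∑' n, g n := by
  have h : ∑ t ∈ Finset.range T, ∑ i ∈ Finset.range (t + 1), f i * g (t - i) =
      ∑ i ∈ Finset.range T, ∑ t ∈ Finset.Ico i T, f i * g (t - i) := by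
    refine Finset.sum_comm' fun t i => ?_
    simp only [Finset.mem_range, Finset.mem_Ico]
    omega
  rw [h, Finset.sum_mul]
  refine Finset.sum_le_sum fun i _ => ?_
  rw [← Finset.mul_sum, Finset.sum_Ico_eq_sum_range]
  simp only [Nat.add_sub_cancel_left]
  gcongr
  exact ENNReal.sum_le_tsum _

variable {X : Type u}

/-- The indicator of a difference at index `n`, zero beyond the horizon. -/
def diffAt {k : ℕ} (r : Fin k → X × X) (n : ℕ) : ℝ≥0∞ :=
  if h : n < k then diff (r ⟨n, h⟩) else 0

theorem diffAt_of_lt {k : ℕ} (r : Fin k → X × X) {n : ℕ} (h : n < k) :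
    diffAt r n = diff (r ⟨n, h⟩) := dif_pos h

theorem diffAt_init {k : ℕ} (r : Fin (k + 1) → X × X) {n : ℕ} (h : n < k) :
    diffAt (Fin.init r : Fin k → X × X) n = diffAt r n := by
  rw [diffAt_of_lt _ h, diffAt_of_lt _ (h.trans (Nat.lt_succ_self k))]
  rfl

theorem min_one_mul_diff_le (c x y : ℝ≥0∞) (p : X × X) (h : min 1 (c * x) ≤ y) :
    min 1 (c * (diff p * x)) ≤ diff p * y := by
  by_cases hp : p.1 = p.2
  · simp [diff_of_eq hp]
  · simpa [diff_of_ne hp] using h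

theorem mul_spread_le (c : ℝ≥0∞) (N n : ℕ) : min 1 (c * spread c N n) ≤ spread c N (n + 1) := by
  refine min_le_min_left _ ?_
  rw [pow_succ', mul_div_assoc]
  gcongr
  exact min_le_right _ _

/-- The weighted count of the differences between two trajectories. -/
def weightedDiff (a : ℝ≥0∞) {k : ℕ} (r : Fin k → X × X) : ℝ≥0∞ :=
  ∑ t : Fin k, a ^ (t : ℕ) * diff (r t)

theorem weightedDiff_snoc (a : ℝ≥0∞) {k : ℕ} (r : Fin k → X × X) (y : X × X) :
    weightedDiff a (Fin.snoc r y : Fin (k + 1) → X × X) = weightedDiff a r + a ^ k * diff y := by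
  simp [weightedDiff, Fin.sum_univ_castSucc]

theorem weightedDiff_eq_sum_range (a : ℝ≥0∞) {k : ℕ} (r : Fin k → X × X) :
    weightedDiff a r = ∑ t ∈ Finset.range k, a ^ t * diffAt r t := by
  rw [← Fin.sum_univ_eq_sum_range (fun t => a ^ t * diffAt r t)]
  exact Finset.sum_congr rfl fun t _ => by rw [diffAt_of_lt r t.2]

/-- Comparison with the full geometric series makes the bound independent of the horizon. -/
theorem weightedDiff_le_inv (a : ℝ≥0∞) {T : ℕ} (r : Fin T → X × X) : weightedDiff a r ≤ (1 - a)⁻¹ := by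
  rw [weightedDiff_eq_sum_range, ← ENNReal.tsum_geometric]
  refine le_trans (Finset.sum_le_sum fun t ht => ?_) (ENNReal.sum_le_tsum (Finset.range T))
  refine mul_le_of_le_one_right' ?_
  rw [diffAt_of_lt _ (Finset.mem_range.mp ht)]
  exact diff_le_one _

theorem pow_le_weightedDiff {a : ℝ≥0∞} (ha : a ≤ 1) {T : ℕ} (r : Fin T → X × X)
    (h : ¬ ∀ t, (r t).1 = (r t).2) : a ^ T ≤ weightedDiff a r := by
  push Not at h
  obtain ⟨t, ht⟩ := h
  calc a ^ T ≤ a ^ (t : ℕ) * diff (r t) := by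
        rw [diff_of_ne ht, mul_one]
        exact pow_le_pow_right_of_le_one' ha t.2.le
    _ ≤ _ := Finset.single_le_sum (f := fun t : Fin T => a ^ (t : ℕ) * diff (r t))
        (fun _ _ => zero_le) (Finset.mem_univ t)

end Spread

section Forward

variable {X : Type u} [MeasurableSpace X] {μ : Measure X} {N : ℕ} [NeZero N]

theorem lintegral_forward_zero (m : Model X μ) (σ : Mutation m N) (r : Fin 1 → X × X)
    {f : (Fin 1 → State X N) → ℝ≥0∞} (hf : Measurable f) :
    ∫⁻ h, f h ∂(forward m σ 0 r) = ∫⁻ s, f (fun _ => s) ∂(initKernel m N (r 0)) := by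
  rw [forward, Kernel.lintegral_map _ (by fun_prop) _ hf, Kernel.lintegral_comap]

theorem lintegral_forward_succ (m : Model X μ) (σ : Mutation m N) (k : ℕ)
    (r : Fin (k + 2) → X × X) {f : (Fin (k + 2) → State X N) → ℝ≥0∞} (hf : Measurable f) :
    ∫⁻ h, f h ∂(forward m σ (k + 1) r) =
      ∫⁻ h, ∫⁻ s, f (Fin.snoc h s) ∂(stepKernel m σ k (r (Fin.last (k + 1)), h (Fin.last k)))
        ∂(forward m σ k (Fin.init r)) := by
  have h : Measurable fun p : (Fin (k + 1) → State X N) × State X N =>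
      f (Fin.snoc p.1 p.2 : Fin (k + 2) → State X N) := hf.comp (measurable_snoc (k + 1))
  rw [forward, Kernel.lintegral_map _ (measurable_snoc (k + 1)) _ hf,
    Kernel.lintegral_compProd _ _ _ h]
  rfl

variable [MeasurableEq X] {m : Model X μ} {T : ℕ} {ε : ℝ≥0}

/-- Induction on the length of the forward pass. The cap is renewed at every step: uncapped, the
contributions c^n/N need not be summable against a^n, since c ≥ 2 while a may be close to 1. -/
theorem lintegral_forward_unmatched_le (hm : m.StrongMixing T) (hε : 0 < ε) (hε1 : ε ≤ 1)
    (he : (ε : ℝ≥0∞) ≤ m.epsConst T) (σ : Mutation m N) (k : ℕ) (hk : k < T)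
    (r : Fin (k + 1) → X × X) (j : Fin (k + 1)) :
    ∫⁻ h, unmatched m j (h j) ∂(forward m σ k r) ≤
      ∑ i ∈ Finset.range (j + 1), diffAt r i * spread (2 * (ε : ℝ≥0∞)⁻¹) N (j - i) := by
  have hmeas (n k : ℕ) (j : Fin k) : Measurable fun h : Fin k → State X N =>
      unmatched m n (h j) := (measurable_unmatched m n).comp (measurable_pi_apply j)
  have hmin (p : X × X) : min 1 (diff p / N) ≤ diff p * spread (2 * (ε : ℝ≥0∞)⁻¹) N 0 := by
    have := min_one_mul_diff_le (N : ℝ≥0∞)⁻¹ 1 (spread (2 * (ε : ℝ≥0∞)⁻¹) N 0) p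
      (by simp [spread])
    rwa [mul_one, mul_comm, ← div_eq_mul_inv] at this
  induction k with
  | zero =>
    obtain rfl : j = 0 := Fin.fin_one_eq_zero j
    rw [lintegral_forward_zero _ _ _ (hmeas _ _ _)]
    refine (lintegral_initKernel_le m (r 0)).trans ?_
    simpa [diffAt] using hmin (r 0)
  | succ k ih =>
    rw [lintegral_forward_succ _ _ _ _ (hmeas _ _ _)]
    induction j using Fin.lastCases with
    | cast j =>
      simp only [Fin.snoc_castSucc, lintegral_const, measure_univ, mul_one, Fin.val_castSucc]
      refine (ih (by omega) (Fin.init r) j).trans_eq (Finset.sum_congr rfl fun i hi => ?_)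
      rw [diffAt_init r (by have := Finset.mem_range.mp hi; omega)]
    | last =>
      simp only [Fin.snoc_last, Fin.val_last]
      set c := 2 * (ε : ℝ≥0∞)⁻¹
      have h1 : ∫⁻ h, ∫⁻ s, unmatched m (k + 1) s
          ∂(stepKernel m σ k (r (Fin.last (k + 1)), h (Fin.last k)))
          ∂(forward m σ k (Fin.init r)) ≤ 1 :=
        (lintegral_mono fun h => lintegral_stepKernel_unmatched_le_one m σ k _ _).trans (by simp)
      have h2 : ∫⁻ h, ∫⁻ s, unmatched m (k + 1) s
          ∂(stepKernel m σ k (r (Fin.last (k + 1)), h (Fin.last k)))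
          ∂(forward m σ k (Fin.init r)) ≤ diff (r (Fin.last (k + 1))) / N +
            ∑ i ∈ Finset.range (k + 1), c * (diffAt r i * spread c N (k - i)) := by
        refine (lintegral_mono fun h =>
          lintegral_stepKernel_unmatched_le hm hε hε1 he σ (by omega) _ _).trans ?_
        rw [lintegral_add_left measurable_const, lintegral_const, measure_univ, mul_one,
          lintegral_const_mul _ (hmeas _ _ _), ← Finset.mul_sum]
        gcongr
        refine (ih (by omega) (Fin.init r) (Fin.last k)).trans_eq
          (Finset.sum_congr rfl fun i hi => ?_)
        rw [diffAt_init r (by simpa using hi), Fin.val_last]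
      refine (le_min h1 h2).trans ?_
      rw [add_comm (diff _ / _), Finset.sum_range_succ _ (k + 1), Nat.sub_self]
      -- The sources are indexed by `Option`: `none` is the new reference pair, `some i` the
      -- difference at an earlier time `i`, carried on by one more step.
      have h3 := min_one_sum_le (Finset.univ : Finset (Option (Fin (k + 1))))
        (fun o => o.elim (diff (r (Fin.last (k + 1))) / N)
          fun i => c * (diffAt r i * spread c N (k - i)))
      simp only [Fintype.sum_option, Option.elim_none, Option.elim_some] at h3
      rw [← Fin.sum_univ_eq_sum_range (fun i => c * (diffAt r i * spread c N (k - i))),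
        ← Fin.sum_univ_eq_sum_range (fun i => diffAt r i * spread c N (k + 1 - i)),
        add_comm (∑ i, _), add_comm (∑ i, _)]
      refine h3.trans (add_le_add ?_ (Finset.sum_le_sum fun i _ => ?_))
      · rw [diffAt_of_lt r (Nat.lt_succ_self _)]
        exact hmin _
      · rw [diffAt_of_lt r (by omega), Nat.succ_sub (by omega)]
        exact min_one_mul_diff_le _ _ _ _ (mul_spread_le c N _)

end Forward

/-! ### The backward pass -/

section Backward

variable {X : Type u} [MeasurableSpace X] {μ : Measure X} {N : ℕ} [NeZero N]

theorem lintegral_backward_zero (m : Model X μ) (h : Fin 1 → State X N) (w : Weights N)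
    {f : (Fin 1 → X × X) → ℝ≥0∞} (hf : Measurable f) :
    ∫⁻ y, f y ∂(backward m 0 (h, w)) =
      ∑ a, (cresMass w.1 w.2 a : ℝ≥0∞) * f fun _ => select (h 0).1 a := by
  have hs : Measurable fun p : ((Fin 1 → State X N) × Weights N) × (Fin N × Fin N) =>
      (fun _ => select (p.1.1 0).1 p.2 : Fin 1 → X × X) := by
    refine measurable_pi_iff.mpr fun _ => ?_
    exact measurable_select.comp (f := fun p : ((Fin 1 → State X N) × Weights N) ×
      (Fin N × Fin N) => ((p.1.1 0).1, p.2)) (by fun_prop)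
  have hfs : Measurable fun p : ((Fin 1 → State X N) × Weights N) × (Fin N × Fin N) =>
      f (fun _ => select (p.1.1 0).1 p.2) := hf.comp hs
  rw [backward, Kernel.lintegral_map _ hs _ hf, Kernel.lintegral_id_prod hfs,
    Kernel.lintegral_comap, lintegral_cres]

theorem lintegral_backward_succ (m : Model X μ) (k : ℕ) (h : Fin (k + 2) → State X N)
    (w : Weights N) {f : (Fin (k + 2) → X × X) → ℝ≥0∞} (hf : Measurable f) :
    ∫⁻ y, f y ∂(backward m (k + 1) (h, w)) =
      ∑ a, (cresMass w.1 w.2 a : ℝ≥0∞) *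
        ∫⁻ y, f (Fin.snoc y (select (h (Fin.last (k + 1))).1 a))
          ∂(backward m k (Fin.init h, backWeights m k (h (Fin.last k).castSucc)
            (select (h (Fin.last (k + 1))).1 a))) := by
  have hs : Measurable fun p : ((Fin (k + 2) → State X N) × Weights N) × (Fin N × Fin N) =>
      select (p.1.1 (Fin.last (k + 1))).1 p.2 :=
    measurable_select.comp (f := fun p : ((Fin (k + 2) → State X N) × Weights N) ×
      (Fin N × Fin N) => ((p.1.1 (Fin.last (k + 1))).1, p.2)) (by fun_prop)
  have : IsMarkovKernel ((Kernel.id ×ₖ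
      (cres N).comap (fun p : (Fin (k + 2) → State X N) × Weights N => p.2) (by fun_prop)).map
      fun p => select (p.1.1 (Fin.last (k + 1))).1 p.2) := Kernel.IsMarkovKernel.map _ hs
  have hsw : Measurable fun p : (X × X) × (Fin (k + 1) → X × X) =>
      (Fin.snoc p.2 p.1 : Fin (k + 2) → X × X) := (measurable_snoc (k + 1)).comp measurable_swap
  have hfs : Measurable fun p : (X × X) × (Fin (k + 1) → X × X) =>
      f (Fin.snoc p.2 p.1 : Fin (k + 2) → X × X) := hf.comp hsw
  have hw : Measurable fun y : X × X => ((Fin.init h : Fin (k + 1) → State X N),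
      backWeights m k (h (Fin.last k).castSucc) y) :=
    measurable_const.prodMk ((measurable_backWeights m k).comp
      (f := fun y : X × X => (h (Fin.last k).castSucc, y)) (by fun_prop))
  have hin : Measurable fun y : X × X => ∫⁻ z, f (Fin.snoc z y : Fin (k + 2) → X × X)
      ∂((backward m k).comap _ hw y) :=
    Measurable.lintegral_kernel_prod_right' (κ := (backward m k).comap _ hw) hfs
  have hin' : Measurable fun p : ((Fin (k + 2) → State X N) × Weights N) × (Fin N × Fin N) =>
      ∫⁻ z, f (Fin.snoc z (select (p.1.1 (Fin.last (k + 1))).1 p.2) : Fin (k + 2) → X × X)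
      ∂((backward m k).comap _ hw (select (p.1.1 (Fin.last (k + 1))).1 p.2)) := hin.comp hs
  rw [backward, Kernel.lintegral_map _ hsw _ hf, Kernel.lintegral_compProd _ _ _ hfs]
  refine (Kernel.lintegral_map _ hs _ hin).trans ?_
  rw [Kernel.lintegral_id_prod hin', Kernel.lintegral_comap, lintegral_cres]
  rfl

theorem measurable_weightedDiff [MeasurableEq X] (a : ℝ≥0∞) (k : ℕ) :
    Measurable (weightedDiff a : (Fin k → X × X) → ℝ≥0∞) :=
  Finset.measurable_sum _ fun t _ =>
    (measurable_diff.comp (measurable_pi_apply t)).const_mul _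

variable {m : Model X μ} {T : ℕ} {ε : ℝ≥0}

/-- When the selected successors agree, a matched particle has equal backward weights in both
systems and the good regime applies; otherwise only the overlap of balanced weights is left. -/
theorem selectDiff_backWeights_le (hm : m.StrongMixing T) (hε : 0 < ε) (hε1 : ε ≤ 1)
    (he : (ε : ℝ≥0∞) ≤ m.epsConst T) {t : ℕ} (ht : t + 1 < T) (s : State X N) (y : X × X) :
    selectDiff s.1 (backWeights m t s y) ≤
      (1 - ε : ℝ≥0) * diff y + (ε : ℝ≥0∞)⁻¹ * unmatched m t s := by
  by_cases hs : InRange m t s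
  swap
  · rw [unmatched, if_neg hs, ENNReal.mul_top (by simp), add_top]
    exact le_top
  obtain ⟨h1, h2⟩ := hs.balanced_backWeights hm he ht y
  rw [unmatched_of_inRange hs]
  by_cases hy : y.1 = y.2
  · rw [diff_of_eq hy, mul_zero, zero_add]
    refine selectDiff_le_of_weights_eq hε _ _ h1 h2 _ (fun i hi => (not_mem_unmatchedSet.mp hi).1)
      fun i hi => ?_
    obtain ⟨h3, h4⟩ := not_mem_unmatchedSet.mp hi
    simp only [backWeights, h3, h4, hy]
  · rw [diff_of_ne hy, mul_one]
    refine (selectDiff_le hε1 _ _ h1 h2 _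
      (fun i hi => (not_mem_unmatchedSet.mp hi).1)).trans ?_
    gcongr
    refine le_mul_of_one_le_left' ?_
    rw [ENNReal.one_le_inv]
    exact_mod_cast hε1

theorem sum_cresMass_mul_const (w : Weights N) (c : ℝ≥0∞) :
    ∑ a, (cresMass w.1 w.2 a : ℝ≥0∞) * c = c := by
  rw [← Finset.sum_mul, ← ENNReal.ofNNReal_finsetSum, sum_cresMass, ENNReal.coe_one, one_mul]

variable [MeasurableEq X]

/-- `A` prices a selected difference together with all the earlier ones it may cause. Multiplied by
a^k, `haA` says that a difference at k + 1, of price A a^(k+1), covers its own weight a^(k+1) and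
its expected share A (1 - ε) a^k in the price at k. -/
theorem lintegral_backward_weightedDiff_le (hm : m.StrongMixing T) (hε : 0 < ε) (hε1 : ε ≤ 1)
    (he : (ε : ℝ≥0∞) ≤ m.epsConst T) {a A : ℝ≥0∞} (hA : 1 ≤ A)
    (haA : a + A * (1 - ε : ℝ≥0) ≤ A * a) (k : ℕ) (hk : k < T) (h : Fin (k + 1) → State X N)
    (w : Weights N) :
    ∫⁻ y, weightedDiff a y ∂(backward m k (h, w)) ≤
      A * a ^ k * selectDiff (h (Fin.last k)).1 w +
        ∑ t : Fin k, A * (ε : ℝ≥0∞)⁻¹ * (a ^ (t : ℕ) * unmatched m t (h t.castSucc)) := by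
  induction k generalizing w with
  | zero =>
    rw [lintegral_backward_zero m h w (measurable_weightedDiff a 1)]
    simp only [weightedDiff, Finset.univ_unique, Fin.default_eq_zero, Finset.sum_singleton,
      Fin.val_zero, pow_zero, one_mul, mul_one, Finset.univ_eq_empty, Finset.sum_empty, add_zero]
    exact le_mul_of_one_le_left' hA
  | succ k ih =>
    rw [lintegral_backward_succ m k h w (measurable_weightedDiff a (k + 2))]
    set s := h (Fin.last k).castSucc
    set R := ∑ t : Fin k, A * (ε : ℝ≥0∞)⁻¹ *
      (a ^ (t : ℕ) * unmatched m t (h t.castSucc.castSucc))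
    have h1 (y : X × X) : ∫⁻ z, weightedDiff a (Fin.snoc z y : Fin (k + 2) → X × X)
        ∂(backward m k (Fin.init h, backWeights m k s y)) ≤
          A * a ^ (k + 1) * diff y + (R + A * (ε : ℝ≥0∞)⁻¹ * (a ^ k * unmatched m k s)) := by
      simp only [weightedDiff_snoc]
      rw [lintegral_add_right _ measurable_const, lintegral_const, measure_univ, mul_one]
      refine (add_le_add_left (ih (by omega) (Fin.init h) (backWeights m k s y)) _).trans ?_
      change A * a ^ k * selectDiff s.1 (backWeights m k s y) + R + a ^ (k + 1) * diff y ≤ _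
      calc A * a ^ k * selectDiff s.1 (backWeights m k s y) + R + a ^ (k + 1) * diff y
          ≤ A * a ^ k * ((1 - ε : ℝ≥0) * diff y + (ε : ℝ≥0∞)⁻¹ * unmatched m k s) + R +
              a ^ (k + 1) * diff y := by
            gcongr
            exact selectDiff_backWeights_le hm hε hε1 he (by omega) s y
        _ = (a + A * (1 - ε : ℝ≥0)) * (a ^ k * diff y) +
              (R + A * (ε : ℝ≥0∞)⁻¹ * (a ^ k * unmatched m k s)) := by ring
        _ ≤ A * a * (a ^ k * diff y) +
              (R + A * (ε : ℝ≥0∞)⁻¹ * (a ^ k * unmatched m k s)) := by gcongr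
        _ = _ := by ring
    refine (Finset.sum_le_sum fun b _ => mul_le_mul_right (h1 _) _).trans_eq ?_
    simp only [mul_add _ (_ * diff _)]
    rw [Finset.sum_add_distrib, sum_cresMass_mul_const, Fin.sum_univ_castSucc, selectDiff,
      Finset.mul_sum]
    congr 1
    exact Finset.sum_congr rfl fun b _ => by ring

/-- The factor by which CCBPF contracts the weighted count of the differences. -/
def rate (ε : ℝ≥0) (a A : ℝ≥0∞) (N : ℕ) : ℝ≥0∞ :=
  A * (ε : ℝ≥0∞)⁻¹ * ∑' n, a ^ n * spread (2 * (ε : ℝ≥0∞)⁻¹) N n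

theorem lintegral_ccbpf_weightedDiff_le (hm : m.StrongMixing T) (hε : 0 < ε) (hε1 : ε ≤ 1)
    (he : (ε : ℝ≥0∞) ≤ m.epsConst T) {a A : ℝ≥0∞} (hA : 1 ≤ A)
    (haA : a + A * (1 - ε : ℝ≥0) ≤ A * a) (hT : 1 ≤ T) (σ : Mutation m N)
    (r : Fin T → X × X) :
    ∫⁻ y, weightedDiff a y ∂(ccbpf m σ T r) ≤ rate ε a A N * weightedDiff a r := by
  obtain ⟨k, rfl⟩ : ∃ k, T = k + 1 := ⟨T - 1, by omega⟩
  have hu (t : Fin (k + 1)) : Measurable fun h : Fin (k + 1) → State X N =>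
      unmatched m t (h t) := (measurable_unmatched m t).comp (measurable_pi_apply t)
  set c := 2 * (ε : ℝ≥0∞)⁻¹ with hc
  rw [ccbpf, Kernel.lintegral_comp _ _ _ (measurable_weightedDiff a (k + 1))]
  simp only [Kernel.lintegral_comap]
  calc ∫⁻ h, ∫⁻ y, weightedDiff a y ∂(backward m k (h, (h (Fin.last k)).2)) ∂(forward m σ k r)
      ≤ ∫⁻ h, ∑ t : Fin (k + 1), A * (ε : ℝ≥0∞)⁻¹ * (a ^ (t : ℕ) * unmatched m t (h t))
          ∂(forward m σ k r) := by
        refine lintegral_mono fun h => ?_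
        refine (lintegral_backward_weightedDiff_le hm hε hε1 he hA haA k (by omega) h _).trans ?_
        rw [Fin.sum_univ_castSucc, add_comm]
        refine add_le_add le_rfl ?_
        calc A * a ^ k * selectDiff (h (Fin.last k)).1 (h (Fin.last k)).2
            ≤ A * a ^ k * ((ε : ℝ≥0∞)⁻¹ * unmatched m k (h (Fin.last k))) := by
              gcongr
              exact selectDiff_self_le hm hε he (by omega) _
          _ = _ := by rw [Fin.val_last]; ring
    _ = A * (ε : ℝ≥0∞)⁻¹ * ∑ t : Fin (k + 1),
          a ^ (t : ℕ) * ∫⁻ h, unmatched m t (h t) ∂(forward m σ k r) := by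
        rw [lintegral_finsetSum _ fun t _ => ((hu t).const_mul _).const_mul _, Finset.mul_sum]
        refine Finset.sum_congr rfl fun t _ => ?_
        rw [lintegral_const_mul _ ((hu t).const_mul _), lintegral_const_mul _ (hu t)]
    _ ≤ A * (ε : ℝ≥0∞)⁻¹ * ∑ t : Fin (k + 1), a ^ (t : ℕ) *
          ∑ i ∈ Finset.range (t + 1), diffAt r i * spread c N (t - i) := by
        gcongr with t
        exact lintegral_forward_unmatched_le hm hε hε1 he σ k (by omega) r t
    _ = A * (ε : ℝ≥0∞)⁻¹ * ∑ t ∈ Finset.range (k + 1), ∑ i ∈ Finset.range (t + 1),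
          (a ^ i * diffAt r i) * (a ^ (t - i) * spread c N (t - i)) := by
        rw [Fin.sum_univ_eq_sum_range (fun t => a ^ t *
          ∑ i ∈ Finset.range (t + 1), diffAt r i * spread c N (t - i))]
        congr 1
        refine Finset.sum_congr rfl fun t _ => ?_
        rw [Finset.mul_sum]
        refine Finset.sum_congr rfl fun i hi => ?_
        have : i ≤ t := by have := Finset.mem_range.mp hi; omega
        -- Splitting a^t = a^i a^(t-i) turns the double sum into a convolution of the weighted
        -- reference differences with a^n `spread`.
        rw [← Nat.add_sub_of_le this, pow_add, Nat.add_sub_cancel_left]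
        ring
    _ ≤ A * (ε : ℝ≥0∞)⁻¹ * ((∑ i ∈ Finset.range (k + 1), a ^ i * diffAt r i) *
          ∑' n, a ^ n * spread c N n) := by
        gcongr
        exact sum_conv_le (k + 1) (fun i => a ^ i * diffAt r i) (fun n => a ^ n * spread c N n)
    _ = _ := by rw [← weightedDiff_eq_sum_range, rate]; ring

end Backward

/-! ### Contraction along the chain -/

section Chain

variable {X : Type u} [MeasurableSpace X] {μ : Measure X} {N : ℕ} [NeZero N]
  (m : Model X μ) (σ : Mutation m N) {T : ℕ} (s s' : Fin T → X)

instance : IsProbabilityMeasure (chain m σ T s s') := by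
  unfold chain; infer_instance

theorem lintegral_chain_zero {f : (Fin T → X × X) → ℝ≥0∞} (hf : Measurable f) :
    ∫⁻ ω, f (ω 0) ∂(chain m σ T s s') = f fun t => (s t, s' t) := by
  have hf' : Measurable fun h : (i : Finset.Iic 0) → Fin T → X × X =>
      f (h ⟨0, Finset.mem_Iic.mpr le_rfl⟩) := hf.comp (measurable_pi_apply _)
  rw [chain]
  refine (lintegral_map hf'
    (Preorder.measurable_frestrictLe (X := fun _ : ℕ => Fin T → X × X) 0)).symm.trans ?_
  rw [Kernel.traj_map_frestrictLe_apply, Kernel.partialTraj_self, Kernel.lintegral_id' hf']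

theorem lintegral_chain_succ (n : ℕ) {f : (Fin T → X × X) → ℝ≥0∞} (hf : Measurable f) :
    ∫⁻ ω, f (ω (n + 1)) ∂(chain m σ T s s') =
      ∫⁻ ω, ∫⁻ y, f y ∂(ccbpf m σ T (ω n)) ∂(chain m σ T s s') := by
  have hg : Measurable fun h : (i : Finset.Iic n) → Fin T → X × X =>
      ∫⁻ y, f y ∂(ccbpf m σ T (h ⟨n, Finset.mem_Iic.mpr le_rfl⟩)) :=
    hf.lintegral_kernel.comp (measurable_pi_apply _)
  rw [chain]
  set κ : (n : ℕ) → Kernel ((i : Finset.Iic n) → Fin T → X × X) (Fin T → X × X) := fun n =>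
    (ccbpf m σ T).comap
      (fun h : (i : Finset.Iic n) → Fin T → X × X => h ⟨n, Finset.mem_Iic.mpr le_rfl⟩)
      (by fun_prop)
  -- Markov property: the trajectory law is split at time n, the continuation is projected to time n
  -- + 1, where it is the CCBPF kernel, and the past is put back into a trajectory law.
  rw [← Kernel.lintegral_map (Kernel.traj (X := fun _ => Fin T → X × X) κ 0)
      (measurable_pi_apply (n + 1)) _ hf,
    ← Kernel.traj_comp_partialTraj (X := fun _ => Fin T → X × X) (κ := κ) (Nat.zero_le n),
    Kernel.map_comp, Kernel.map_traj_succ_self, Kernel.lintegral_comp _ _ _ hf,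
    Kernel.traj_comp_partialTraj (X := fun _ => Fin T → X × X) (κ := κ) (Nat.zero_le n),
    ← Kernel.traj_map_frestrictLe,
    Kernel.lintegral_map _ (Preorder.measurable_frestrictLe n) _ hf.lintegral_kernel]
  rfl

variable [MeasurableEq X] {m} {ε : ℝ≥0}

theorem lintegral_chain_weightedDiff_le (hm : m.StrongMixing T) (hε : 0 < ε) (hε1 : ε ≤ 1)
    (he : (ε : ℝ≥0∞) ≤ m.epsConst T) {a A : ℝ≥0∞} (hA : 1 ≤ A)
    (haA : a + A * (1 - ε : ℝ≥0) ≤ A * a) (hT : 1 ≤ T) (n : ℕ) :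
    ∫⁻ ω, weightedDiff a (ω n) ∂(chain m σ T s s') ≤ rate ε a A N ^ n * (1 - a)⁻¹ := by
  induction n with
  | zero =>
    rw [lintegral_chain_zero m σ s s' (measurable_weightedDiff a T), pow_zero, one_mul]
    exact weightedDiff_le_inv a _
  | succ n ih =>
    rw [lintegral_chain_succ m σ s s' n (measurable_weightedDiff a T)]
    refine (lintegral_mono fun ω : ℕ → Fin T → X × X =>
      lintegral_ccbpf_weightedDiff_le hm hε hε1 he hA haA hT σ (ω n)).trans ?_
    have hmeas : Measurable fun ω : ℕ → Fin T → X × X => weightedDiff a (ω n) :=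
      (measurable_weightedDiff a T).comp (measurable_pi_apply n)
    rw [lintegral_const_mul _ hmeas, pow_succ', mul_assoc]
    gcongr

/-- Markov's inequality. If τ ≥ n + 1 the trajectories differ at iteration n; this needs n ≥ 1,
since τ ignores a coincidence at time 0. -/
theorem measure_le_couplingTime_mul_le (hm : m.StrongMixing T) (hε : 0 < ε) (hε1 : ε ≤ 1)
    (he : (ε : ℝ≥0∞) ≤ m.epsConst T) {a A : ℝ≥0∞} (ha : a ≤ 1) (hA : 1 ≤ A)
    (haA : a + A * (1 - ε : ℝ≥0) ≤ A * a) (hT : 1 ≤ T) {n : ℕ} (hn : 1 ≤ n) :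
    a ^ T * chain m σ T s s' {ω | ((n + 1 : ℕ) : ℕ∞) ≤ couplingTime ω} ≤
      rate ε a A N ^ n * (1 - a)⁻¹ := by
  refine le_trans ?_ (lintegral_chain_weightedDiff_le σ s s' hm hε hε1 he hA haA hT n)
  refine le_trans ?_ (mul_meas_ge_le_lintegral₀
    ((measurable_weightedDiff a T).comp (measurable_pi_apply n)).aemeasurable (a ^ T))
  refine mul_le_mul_right (measure_mono fun ω hω => ?_) _
  refine pow_le_weightedDiff ha _ fun h => ?_
  have h1 : couplingTime ω ≤ n := iInf₂_le n ⟨hn, h⟩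
  have h2 : ((n + 1 : ℕ) : ℕ∞) ≤ n := le_trans hω h1
  have h3 : n + 1 ≤ n := by exact_mod_cast h2
  omega

end Chain

/-! ### Choice of parameters and tail bounds -/

theorem tendsto_rate {ε : ℝ≥0} (hε : 0 < ε) {a A : ℝ≥0∞} (ha : a < 1) (hA : A ≠ ∞) :
    Tendsto (rate ε a A) atTop (𝓝 0) := by
  have hε' : (ε : ℝ≥0∞)⁻¹ ≠ ∞ := by simp [hε.ne']
  have h : Tendsto (fun N : ℕ => ∑' n, a ^ n * spread (2 * (ε : ℝ≥0∞)⁻¹) N n) atTop (𝓝 0) := by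
    simp only [← lintegral_count]
    have h0 : ∫⁻ _ : ℕ, (0 : ℝ≥0∞) ∂Measure.count = 0 := by simp
    rw [← h0]
    -- The cap in `spread` provides the dominating sequence a^n, summable as a < 1; for fixed n the
    -- term is at most a^n c^n/N, which tends to 0.
    refine tendsto_lintegral_of_dominated_convergence (fun n => a ^ n)
      (fun _ => measurable_of_countable _) (fun N => ae_of_all _ fun n => ?_) ?_
      (ae_of_all _ fun n => ?_)
    · exact mul_le_of_le_one_right' (min_le_left _ _)
    · rw [lintegral_count, ENNReal.tsum_geometric]
      exact ENNReal.inv_ne_top.mpr (tsub_pos_of_lt ha).ne'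
    · have h1 : Tendsto (fun N : ℕ => a ^ n * ((2 * (ε : ℝ≥0∞)⁻¹) ^ n * (N : ℝ≥0∞)⁻¹)) atTop
          (𝓝 (a ^ n * ((2 * (ε : ℝ≥0∞)⁻¹) ^ n * 0))) :=
        ENNReal.Tendsto.const_mul (ENNReal.Tendsto.const_mul ENNReal.tendsto_inv_nat_nhds_zero
          (Or.inr (ENNReal.pow_ne_top (ENNReal.mul_ne_top (by simp) hε'))))
          (Or.inr (ENNReal.pow_ne_top (ha.trans ENNReal.one_lt_top).ne))
      rw [mul_zero, mul_zero] at h1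
      refine tendsto_of_tendsto_of_tendsto_of_le_of_le tendsto_const_nhds h1
        (fun _ => zero_le) fun N => ?_
      dsimp only
      gcongr
      exact min_le_right _ _
  have := ENNReal.Tendsto.const_mul (a := A * (ε : ℝ≥0∞)⁻¹) h
    (Or.inr (ENNReal.mul_ne_top hA hε'))
  rwa [mul_zero] at this

/-- Explains the target rate (1 - a) β⁻²: the factor 1 - a cancels the initial bound 1/(1 - a), and
the square makes up for the iteration lost in the Markov bound, as 2(p + 1) ≥ p + 2. -/
theorem pow_mul_inv_le {a β : ℝ≥0} (ha : a < 1) (hβ : 1 ≤ β) (p : ℕ) :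
    ((1 - a) * (β ^ 2)⁻¹) ^ (p + 1) * (1 - a)⁻¹ ≤ (β ^ (p + 2))⁻¹ := by
  have h0 : 1 - a ≠ 0 := (tsub_pos_of_lt ha).ne'
  calc ((1 - a) * (β ^ 2)⁻¹) ^ (p + 1) * (1 - a)⁻¹
      = (1 - a) ^ p * (β ^ (2 * (p + 1)))⁻¹ := by
        rw [mul_pow, pow_succ, inv_pow, pow_mul]
        field_simp
    _ ≤ (β ^ (2 * (p + 1)))⁻¹ := mul_le_of_le_one_left' (pow_le_one' tsub_le_self p)
    _ ≤ (β ^ (p + 2))⁻¹ := by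
        have : 0 < β := lt_of_lt_of_le one_pos hβ
        gcongr
        omega

/-- The bound `α ^ T * β ^ (-n)` on the tail of the coupling time, for all models with a given
lower bound on the mixing constant. -/
theorem exists_forall_tailProb_le (ε : ℝ≥0) (hε : 0 < ε) (α β : ℝ) (hα : 1 < α) (hβ : 1 < β) :
    ∃ N₀ : ℕ, ∀ (X : Type u) [MeasurableSpace X] [MeasurableEq X] (μ : Measure X)
      (T : ℕ) (m : Model X μ), 1 ≤ T → m.StrongMixing T → (ε : ℝ≥0∞) ≤ m.epsConst T →
      ∀ (N : ℕ) [NeZero N], N₀ ≤ N → ∀ (σ : Mutation m N) (s s' : Fin T → X) (n : ℕ), n ≠ 1 →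
        tailProb m σ T s s' n ≤ α ^ T * (β ^ n)⁻¹ := by
  set η : ℝ≥0 := min ε 1
  have hη : 0 < η := lt_min hε one_pos
  have hη1 : η ≤ 1 := min_le_right _ _
  lift α to ℝ≥0 using by linarith
  lift β to ℝ≥0 using by linarith
  have hα' : (1 : ℝ≥0) < α := by exact_mod_cast hα
  have hβ' : (1 : ℝ≥0) < β := by exact_mod_cast hβ
  have hq : 1 - η < 1 := tsub_lt_self one_pos hη
  -- a > 1/α turns a^(-T) into at most α^T, a > 1 - η is needed in the backward pass and a < 1 in
  -- the forward pass.
  obtain ⟨a, ha0, ha1⟩ : ∃ a : ℝ≥0, max α⁻¹ (1 - η) < a ∧ a < 1 :=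
    exists_between (max_lt (inv_lt_one_of_one_lt₀ hα') hq)
  obtain ⟨haα, haq⟩ := max_lt_iff.mp ha0
  have hapos : 0 < a := lt_of_le_of_lt zero_le haq
  have hd : 0 < a - (1 - η) := tsub_pos_of_lt haq
  -- The solution of a + A(1 - η) = Aa.
  set A : ℝ≥0 := a / (a - (1 - η))
  have hA : (1 : ℝ≥0∞) ≤ A := by
    have : 1 ≤ A := (one_le_div hd).mpr tsub_le_self
    exact_mod_cast this
  have haA : (a : ℝ≥0∞) + A * (1 - η : ℝ≥0) ≤ A * a := by
    have h1 : A * (a - (1 - η)) = a := div_mul_cancel₀ _ hd.ne'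
    have : a + A * (1 - η) = A * a := by
      nth_rw 1 [← h1]
      rw [← mul_add, tsub_add_cancel_of_le haq.le]
    exact_mod_cast this.le
  have hθ : (0 : ℝ≥0∞) < (((1 - a) * (β ^ 2)⁻¹ : ℝ≥0) : ℝ≥0∞) := by
    rw [ENNReal.coe_pos]
    exact mul_pos (tsub_pos_of_lt ha1) (inv_pos.mpr (pow_pos (one_pos.trans hβ') 2))
  obtain ⟨N₀, hN₀⟩ := eventually_atTop.mp
    ((tendsto_rate hη (a := (a : ℝ≥0∞)) (by exact_mod_cast ha1)
      (ENNReal.coe_ne_top (r := A))).eventually (gt_mem_nhds hθ))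
  refine ⟨N₀, fun X _ _ μ T m hT hm he N _ hN σ s s' n hn => ?_⟩
  have he' : (η : ℝ≥0∞) ≤ m.epsConst T :=
    le_trans (by exact_mod_cast min_le_left ε 1) he
  have hP : tailProb m σ T s s' n ≤ 1 := measureReal_le_one
  rcases n with _ | _ | p
  · rw [pow_zero, inv_one, mul_one]
    exact hP.trans (one_le_pow₀ hα.le)
  · exact absurd rfl hn
  have h1 := measure_le_couplingTime_mul_le σ s s' hm hη hη1 he' (a := (a : ℝ≥0∞))
    (by exact_mod_cast ha1.le) hA haA hT (n := p + 1) (by omega)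
  have h2 : (a : ℝ≥0∞) ^ T * chain m σ T s s' {ω | ((p + 2 : ℕ) : ℕ∞) ≤ couplingTime ω} ≤
      (((β ^ (p + 2))⁻¹ : ℝ≥0) : ℝ≥0∞) := by
    refine h1.trans (le_trans ?_ (ENNReal.coe_le_coe.mpr (pow_mul_inv_le ha1 hβ'.le p)))
    rw [ENNReal.coe_mul, ENNReal.coe_pow, ENNReal.coe_inv (tsub_pos_of_lt ha1).ne',
      ENNReal.coe_sub, ENNReal.coe_one]
    gcongr
    exact (hN₀ N hN).le
  have h3 := ENNReal.toReal_mono ENNReal.coe_ne_top h2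
  rw [ENNReal.toReal_mul, ENNReal.toReal_pow, ENNReal.coe_toReal, ENNReal.coe_toReal] at h3
  have h4 : (a : ℝ) ^ T * tailProb m σ T s s' (p + 2) ≤ ((β : ℝ) ^ (p + 2))⁻¹ := by
    exact_mod_cast h3
  have h5 : (1 : ℝ) ≤ (α : ℝ) ^ T * (a : ℝ) ^ T := by
    rw [← mul_pow]
    refine one_le_pow₀ ?_
    have : 1 ≤ α * a := by
      rw [← mul_inv_cancel₀ (one_pos.trans hα').ne']
      gcongr
    exact_mod_cast this
  have h6 : 0 ≤ tailProb m σ T s s' (p + 2) := measureReal_nonneg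
  calc tailProb m σ T s s' (p + 2)
      ≤ ((α : ℝ) ^ T * (a : ℝ) ^ T) * tailProb m σ T s s' (p + 2) := le_mul_of_one_le_left h6 h5
    _ = (α : ℝ) ^ T * ((a : ℝ) ^ T * tailProb m σ T s s' (p + 2)) := by ring
    _ ≤ _ := by gcongr

/-- The condition on ρ is equivalent to α < β^ρ, so at n = ⌈ρT⌉ the bound is at most (α/β^ρ)^T. -/
theorem tendsto_of_le_pow_mul_inv_pow {α β ρ : ℝ} (hα : 1 < α) (hβ : 1 < β)
    (hρ : Real.log α / Real.log β < ρ) (p : ℕ → ℕ → ℝ) (h0 : ∀ T n, 0 ≤ p T n)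
    (hp : ∀ T n, 1 < T → n ≠ 1 → p T n ≤ α ^ T * (β ^ n)⁻¹) :
    Tendsto (fun T : ℕ => p T ⌈ρ * T⌉₊) atTop (𝓝 0) := by
  have hα0 : 0 < α := one_pos.trans hα
  have hβ0 : 0 < β := one_pos.trans hβ
  have hlog : 0 < Real.log β := Real.log_pos hβ
  have hρ0 : 0 < ρ := (div_pos (Real.log_pos hα) hlog).trans hρ
  have hlt : α < β ^ ρ := by
    rw [Real.lt_rpow_iff_log_lt hα0 hβ0]
    rwa [div_lt_iff₀ hlog] at hρ
  have hβρ : 0 < β ^ ρ := Real.rpow_pos_of_pos hβ0 ρ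
  have hlim : Tendsto (fun T : ℕ => (α / β ^ ρ) ^ T) atTop (𝓝 0) :=
    tendsto_pow_atTop_nhds_zero_of_lt_one (div_pos hα0 hβρ).le ((div_lt_one hβρ).mpr hlt)
  refine tendsto_of_tendsto_of_tendsto_of_le_of_le' tendsto_const_nhds hlim
    (Eventually.of_forall fun T => h0 _ _) ?_
  -- T > 1/ρ forces ⌈ρT⌉ ≥ 2, away from the excluded value n = 1.
  filter_upwards [eventually_gt_atTop 1, eventually_gt_atTop ⌈ρ⁻¹⌉₊] with T hT hT'
  have h1 : 1 < ρ * T := by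
    have := Nat.lt_of_ceil_lt hT'
    rwa [inv_lt_iff_one_lt_mul₀' hρ0] at this
  have h2 : ⌈ρ * T⌉₊ ≠ 1 := by
    have : 1 < ⌈ρ * T⌉₊ := Nat.lt_ceil.mpr (by exact_mod_cast h1)
    omega
  refine (hp T _ hT h2).trans ?_
  rw [div_pow, div_eq_mul_inv]
  gcongr
  rw [← Real.rpow_natCast, ← Real.rpow_natCast β, ← Real.rpow_mul hβ0.le]
  exact Real.rpow_le_rpow_of_exponent_le hβ.le (Nat.le_ceil _)

end CCBPF

end

theorem theorem3 (ε : ℝ≥0) (hε : 0 < ε) :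
    (∀ ρ : ℝ, 0 < ρ → ∃ N₀ : ℕ,
      ∀ (X : Type u) [MeasurableSpace X] [MeasurableEq X] (μ : Measure X) [SigmaFinite μ]
        (m : ℕ → CCBPF.Model X μ),
        (∀ T, 1 < T → (m T).StrongMixing T ∧ (ε : ℝ≥0∞) ≤ (m T).epsConst T) →
        ∀ (N : ℕ) [NeZero N], N₀ ≤ N →
        ∀ (σ : ∀ T, CCBPF.Mutation (m T) N) (s s' : ∀ T, Fin T → X),
          Tendsto (fun T : ℕ => CCBPF.tailProb (m T) (σ T) T (s T) (s' T) ⌈ρ * T⌉₊) atTop (𝓝 0)) ∧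
    (∀ α β : ℝ, 1 < α → 1 < β → ∃ N₀ : ℕ,
      (∀ (X : Type u) [MeasurableSpace X] [MeasurableEq X] (μ : Measure X) [SigmaFinite μ]
        (T : ℕ) (m : CCBPF.Model X μ), 1 ≤ T → m.StrongMixing T → (ε : ℝ≥0∞) ≤ m.epsConst T →
        ∀ (N : ℕ) [NeZero N], N₀ ≤ N →
        ∀ (σ : CCBPF.Mutation m N) (s s' : Fin T → X) (n : ℕ), n ≠ 1 →
          CCBPF.tailProb m σ T s s' n ≤ α ^ T * (β ^ n)⁻¹) ∧
      (∀ ρ : ℝ, Real.log α / Real.log β < ρ →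
        ∀ (X : Type u) [MeasurableSpace X] [MeasurableEq X] (μ : Measure X) [SigmaFinite μ]
          (m : ℕ → CCBPF.Model X μ),
          (∀ T, 1 < T → (m T).StrongMixing T ∧ (ε : ℝ≥0∞) ≤ (m T).epsConst T) →
          ∀ (N : ℕ) [NeZero N], N₀ ≤ N →
          ∀ (σ : ∀ T, CCBPF.Mutation (m T) N) (s s' : ∀ T, Fin T → X),
            Tendsto (fun T : ℕ => CCBPF.tailProb (m T) (σ T) T (s T) (s' T) ⌈ρ * T⌉₊)
              atTop (𝓝 0))) := by
  have key : ∀ α β : ℝ, 1 < α → 1 < β → ∃ N₀ : ℕ,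
      (∀ (X : Type u) [MeasurableSpace X] [MeasurableEq X] (μ : Measure X) [SigmaFinite μ]
        (T : ℕ) (m : CCBPF.Model X μ), 1 ≤ T → m.StrongMixing T → (ε : ℝ≥0∞) ≤ m.epsConst T →
        ∀ (N : ℕ) [NeZero N], N₀ ≤ N →
        ∀ (σ : CCBPF.Mutation m N) (s s' : Fin T → X) (n : ℕ), n ≠ 1 →
          CCBPF.tailProb m σ T s s' n ≤ α ^ T * (β ^ n)⁻¹) ∧
      (∀ ρ : ℝ, Real.log α / Real.log β < ρ →
        ∀ (X : Type u) [MeasurableSpace X] [MeasurableEq X] (μ : Measure X) [SigmaFinite μ]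
          (m : ℕ → CCBPF.Model X μ),
          (∀ T, 1 < T → (m T).StrongMixing T ∧ (ε : ℝ≥0∞) ≤ (m T).epsConst T) →
          ∀ (N : ℕ) [NeZero N], N₀ ≤ N →
          ∀ (σ : ∀ T, CCBPF.Mutation (m T) N) (s s' : ∀ T, Fin T → X),
            Tendsto (fun T : ℕ => CCBPF.tailProb (m T) (σ T) T (s T) (s' T) ⌈ρ * T⌉₊)
              atTop (𝓝 0)) := by
    intro α β hα hβ
    obtain ⟨N₀, h⟩ := CCBPF.exists_forall_tailProb_le.{u} ε hε α β hα hβ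
    refine ⟨N₀, fun X _ _ μ _ => h X μ, fun ρ hρ X _ _ μ _ m hm N _ hN σ s s' => ?_⟩
    exact CCBPF.tendsto_of_le_pow_mul_inv_pow hα hβ hρ
      (fun T n => CCBPF.tailProb (m T) (σ T) T (s T) (s' T) n) (fun _ _ => measureReal_nonneg)
      fun T n hT hn => h X μ T (m T) hT.le (hm T hT).1 (hm T hT).2 N hN (σ T) (s T) (s' T) n hn
  refine ⟨fun ρ hρ => ?_, key⟩
  -- With α = e and β = e^(2/ρ) the threshold log α / log β equals ρ/2 < ρ.
  have hβ : 1 < Real.exp (2 / ρ) := Real.one_lt_exp_iff.mpr (by positivity)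
  obtain ⟨N₀, -, h⟩ := key (Real.exp 1) (Real.exp (2 / ρ))
    (Real.one_lt_exp_iff.mpr one_pos) hβ
  refine ⟨N₀, h ρ ?_⟩
  rw [Real.log_exp, Real.log_exp, one_div_div]
  linarith
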